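/- **Theorem (SQ lower bound for multiclass linear classification with RCN).** Conventions. For $K\ge 2$ write $[K]$ for the set of labels. A $K$-class linear classifier on $\mathbb{R}^d$ is a function $f(\mathbf{x})=\operatorname{argmax}_{i\in[K]}(\mathbf{w}^{(i)}\cdot\mathbf{x}+t_i)$ with $\mathbf{w}^{(i)}\in\mathbb{R}^d$, $t_i\in\mathbb{R}$ (ties resolved by the smallest index); $\mathcal{L}_{d,K}$ is the class of these. For $\gamma>0$, let $\mathcal{I}_{d,K,\gamma}$ be the set of probability distributions $D$ of $(\mathbf{x},y)\in\mathbb{R}^d\times[K]$ such that $\mathbf{x}\sim\mathcal{N}(\mathbf{0},\mathbf{I})$ and there are $f\in\mathcal{L}_{d,K}$ and a row-stochastic matrix $\mathbf{H}\in\mathbb{R}^{K\times K}$ with $\mathbf{H}_{i,i}>\mathbf{H}_{i,j}+\gamma$ for all $i\ne j$ and $\Pr_D[y=i\mid\mathbf{x}]=\mathbf{H}_{f(\mathbf{x}),i}$ (random classification noise with separation $\gamma$). Put $\mathrm{OPT}(D)=\inf_{f\in\mathcal{L}_{d,K}}\Pr_D[f(\mathbf{x})\ne y]$. A valid oracle for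 $D$ is a fixed function that, for all $u>0$, answers as a $\mathrm{VSTAT}(u)$ oracle: it answers each measurable query $q:\mathbb{R}^d\times[K]\to[-1,1]$ with a value $v$ such that $|v-\mathbf{E}_D[q]|\le\max\big(1/u,\sqrt{\mathrm{Var}_D[q]/u}\big)$. A (randomized) SQ algorithm draws a random seed, then adaptively makes finitely many queries, each with a parameter $u$ of its choice, and outputs a measurable hypothesis $h:\mathbb{R}^d\to[K]$. It learns $\mathcal{L}_{d,K}$ under RCN with separation $\gamma$ to error $\mathrm{OPT}+\epsilon$ if for every $D\in\mathcal{I}_{d,K,\gamma}$ and every valid oracle for $D$, with probability at least $2/3$ over the seed, $\Pr_D[h(\mathbf{x})\ne y]\le\mathrm{OPT}(D)+\epsilon$. Statement. There is a universal constant $C$ such that for every $\delta\in(0,1)$ there are $a,c>0$ and $d_0$, depending only on $\delta$, for which the following holds. Let $d\ge d_0$, $2\le K\le d^{1-\delta}$, $0<\gamma\le K^{-C}$ and $0<\epsilon\le K^{-C}$. Then every SQ algorithm that learns $\mathcal{L}_{d,K}$ under RCN with separation $\gamma$ to error $\mathrm{OPT}+\epsilon$ must, for some $D\in\mathcal{I}_{d,K,\gamma}$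 and some valid oracle for $D$, with positive probability make at least $2^{d^{a}}$ queries or at least one query to $\mathrm{VSTAT}(u)$ with $u\ge d^{cK}$. (In particular this holds for every algorithm that succeeds for all separations $\gamma>0$.) -/

import Mathlib

open MeasureTheory ProbabilityTheory

noncomputable section

namespace SQRCN

/-! ### Statistical queries and SQ algorithms -/

/-- A statistical query on `X`, addressed to the oracle `VSTAT(u)`: a (measurable) function
`X → [-1, 1]` together with the parameter `u > 0`. -/
structure Query (X : Type*) [MeasurableSpace X] where
  /-- the query function -/
  fn : X → ℝ
  measurable_fn : Measurable fn
  bounded_fn : ∀ x, fn x ∈ Set.Icc (-1 : ℝ) 1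
  /-- the parameter of the `VSTAT` oracle that is called -/
  u : ℝ
  u_pos : 0 < u

/-- The tolerance `max (1/u, √(Var_D[q] / u))` with which `VSTAT(u)` answers `q` on `D`. -/
def Query.tolerance {X : Type*} [MeasurableSpace X] (q : Query X) (D : Measure X) : ℝ :=
  max (1 / q.u) (Real.sqrt (variance q.fn D / q.u))

/-- `O` is a valid VSTAT oracle for the distribution `D`: every query gets an answer that is
within the tolerance of the true expectation. -/
def IsVSTAT {X : Type*} [MeasurableSpace X] (O : Query X → ℝ) (D : Measure X) : Prop :=
  ∀ q : Query X, |O q - ∫ x, q.fn x ∂D| ≤ q.tolerance D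

/-- A deterministic adaptive SQ algorithm with outputs in `Y`, as a decision tree: either it stops
with an output, or it makes a query and continues in a way that depends on the answer. -/
inductive SQAlg (X : Type*) [MeasurableSpace X] (Y : Type*) where
  | output (y : Y) : SQAlg X Y
  | query (q : Query X) (next : ℝ → SQAlg X Y) : SQAlg X Y

/-- The output of the algorithm when its queries are answered by `O`. -/
def SQAlg.result {X : Type*} [MeasurableSpace X] {Y : Type*} (O : Query X → ℝ) :
    SQAlg X Y → Y
  | .output y => y
  | .query q next => (next (O q)).result O

/-- The list of the queries that the algorithm makes when they are answered by `O`. -/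
def SQAlg.queries {X : Type*} [MeasurableSpace X] {Y : Type*} (O : Query X → ℝ) :
    SQAlg X Y → List (Query X)
  | .output _ => []
  | .query q next => q :: (next (O q)).queries O

/-! ### Multiclass linear classifiers and random classification noise -/

/-- The class of `K`-class linear classifiers on `ℝ^d`:
`f x = argmax_i (w i · x + t i)`, ties resolved by the smallest index. -/
def linearClassifiers (d K : ℕ) : Set (EuclideanSpace ℝ (Fin d) → Fin K) :=
  {f | ∃ (w : Fin K → EuclideanSpace ℝ (Fin d)) (t : Fin K → ℝ), ∀ x,
    (∀ j, inner ℝ (w j) x + t j ≤ inner ℝ (w (f x)) x + t (f x)) ∧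
    (∀ j, j < f x → inner ℝ (w j) x + t j < inner ℝ (w (f x)) x + t (f x))}

/-- `D` is an RCN distribution for the class `F` with separation `γ`: for some `f ∈ F` and some
row-stochastic confusion matrix `H` with `H i i > H i j + γ` for `j ≠ i`, one has
`Pr_D[y = i | x] = H (f x) i`. -/
def IsRCN {X : Type*} [MeasurableSpace X] {K : ℕ} (F : Set (X → Fin K)) (γ : ℝ)
    (D : Measure (X × Fin K)) : Prop :=
  ∃ f ∈ F, ∃ H ∈ Matrix.rowStochastic ℝ (Fin K),
    (∀ i j, j ≠ i → H i j + γ < H i i) ∧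
    ∀ (i : Fin K) (A : Set X), MeasurableSet A →
      D (A ×ˢ {i}) = ∫⁻ x in A, ENNReal.ofReal (H (f x) i) ∂D.fst

/-- The 0-1 error `Pr_{(x,y) ∼ D}[h x ≠ y]`. -/
def err {X : Type*} [MeasurableSpace X] {K : ℕ} (D : Measure (X × Fin K)) (h : X → Fin K) :
    ENNReal :=
  D {p | h p.1 ≠ p.2}

/-- `OPT = inf_{f ∈ F} Pr_{(x,y) ∼ D}[f x ≠ y]`. -/
def opt {X : Type*} [MeasurableSpace X] {K : ℕ} (F : Set (X → Fin K))
    (D : Measure (X × Fin K)) : ENNReal :=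
  ⨅ f ∈ F, err D f

/-- Labelled examples `(x, y) ∈ ℝ^d × [K]`. -/
abbrev Example (d K : ℕ) : Type := EuclideanSpace ℝ (Fin d) × Fin K

/-- Hypotheses: measurable functions `ℝ^d → [K]`. -/
abbrev Hypothesis (d K : ℕ) : Type := {h : EuclideanSpace ℝ (Fin d) → Fin K // Measurable h}

/-- The admissible input distributions: probability distributions on `ℝ^d × [K]` with standard
Gaussian `x`-marginal, that are RCN distributions with separation `γ` for the `K`-class linear
classifiers. -/
def IsInput (d K : ℕ) (γ : ℝ) (D : Measure (Example d K)) : Prop :=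
  IsProbabilityMeasure D ∧
    D.fst = stdGaussian (EuclideanSpace ℝ (Fin d)) ∧
    IsRCN (linearClassifiers d K) γ D

/-- The randomized SQ algorithm `A` (a deterministic algorithm `A ω` for each random seed `ω ∼ P`)
learns `K`-class linear classifiers under the standard Gaussian with RCN of separation `γ` to error
`OPT + ε`: for every admissible `D` and every valid oracle for `D`, it fails with probability at
most `1/3`. For a set that is not measurable, `P` is the outer measure, so that no measurability
in `ω` is needed. -/
def Learns {Ω : Type*} [MeasurableSpace Ω] (P : Measure Ω) (d K : ℕ) (γ ε : ℝ)
    (A : Ω → SQAlg (Example d K) (Hypothesis d K)) : Prop :=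
  ∀ D : Measure (Example d K), IsInput d K γ D →
    ∀ O : Query (Example d K) → ℝ, IsVSTAT O D →
      P {ω | ¬ err D ((A ω).result O).1 ≤
        opt (linearClassifiers d K) D + ENNReal.ofReal ε} ≤ 1 / 3

end SQRCN

end

namespace SQRCN

/-!
Let the label of a standard Gaussian point `x` depend only on `⟪v, x⟫`, for an unknown unit vector
`v`. A `K`-class linear classifier can cut the line into `K` narrow cells. Project the coordinate
vectors of `ℝ^K` orthogonally to all vectors of cell integrals of polynomials of degree `< n`, where
`n` is proportional to `K`, and perturb the uniform confusion matrix by a multiple of this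
projection: the labels become uncorrelated with all polynomials of degree `< n` in `⟪v, x⟫`. The
diagonal stays dominant because no cell carries more than a small share of the Gaussian mass of such
a polynomial.

The perturbations for directions `v`, `w` with `|⟪v, w⟫| ≤ r` then have correlation at most
`(4 r) ^ n`, which is `d ^ (-Ω(K))` for `r = d ^ (-δ / 4)`, and there are exponentially many
directions that are almost orthogonal in this sense. A query to `VSTAT(u)` with `u < d ^ (c K)`
tells only few of the resulting distributions from the one with uniform labels, so few queries leave
most directions indistinguishable and the same hypothesis is output for them. But a near-optimal
hypothesis for `v` correlates with the perturbation for `v`, and, as the perturbations are almost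
orthogonal, one hypothesis does so for only few directions.
-/

/-! ### Almost orthogonal vectors -/

section AlmostOrthogonal

variable {ι E : Type*} [NormedAddCommGroup E] [InnerProductSpace ℝ E]

theorem norm_sq_sum_smul_le {S : Finset ι} {g : ι → E} {β τ : ℝ} (hτ0 : 0 ≤ τ)
    (hβ : ∀ i ∈ S, ‖g i‖ ^ 2 ≤ β)
    (hτ : ∀ i ∈ S, ∀ j ∈ S, i ≠ j → |inner ℝ (g i) (g j)| ≤ τ)
    {a : ι → ℝ} (ha : ∀ i, |a i| ≤ 1) :
    ‖∑ i ∈ S, a i • g i‖ ^ 2 ≤ S.card * β + S.card ^ 2 * τ := by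
  classical
  have hterm : ∀ i ∈ S, ∀ j ∈ S,
      inner ℝ (a i • g i) (a j • g j) ≤ (if i = j then β else 0) + τ := by
    intro i hi j hj
    have haij : |a i| * |a j| ≤ 1 := mul_le_one₀ (ha i) (abs_nonneg _) (ha j)
    have habs : inner ℝ (a i • g i) (a j • g j) ≤ |inner ℝ (g i) (g j)| := by
      rw [real_inner_smul_left, real_inner_smul_right, ← mul_assoc]
      refine (le_abs_self _).trans ?_
      rw [abs_mul, abs_mul]
      exact mul_le_of_le_one_left (abs_nonneg _) haij
    split_ifs with hij
    · subst hij
      rw [real_inner_self_eq_norm_sq (g i), abs_of_nonneg (sq_nonneg _)] at habs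
      linarith [hβ i hi]
    · linarith [hτ i hi j hj hij]
  calc ‖∑ i ∈ S, a i • g i‖ ^ 2 = ∑ i ∈ S, ∑ j ∈ S, inner ℝ (a i • g i) (a j • g j) := by
        rw [← real_inner_self_eq_norm_sq, sum_inner]
        simp only [inner_sum]
    _ ≤ ∑ i ∈ S, ∑ j ∈ S, ((if i = j then β else 0) + τ) :=
        Finset.sum_le_sum fun i hi => Finset.sum_le_sum fun j hj => hterm i hi j hj
    _ = S.card * β + S.card ^ 2 * τ := by
        simp only [Finset.sum_add_distrib, Finset.sum_ite_eq, Finset.sum_ite_mem, Finset.inter_self,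
          Finset.sum_const, nsmul_eq_mul]
        ring

theorem card_mul_sq_le_of_le_abs_inner {S : Finset ι} {g : ι → E} {β τ t : ℝ} (hβ0 : 0 ≤ β)
    (hτ0 : 0 ≤ τ) (hβ : ∀ i ∈ S, ‖g i‖ ^ 2 ≤ β)
    (hτ : ∀ i ∈ S, ∀ j ∈ S, i ≠ j → |inner ℝ (g i) (g j)| ≤ τ)
    {q : E} (ht : 0 ≤ t) (hq : ∀ i ∈ S, t ≤ |inner ℝ q (g i)|) (hqτ : 2 * (‖q‖ ^ 2 * τ) ≤ t ^ 2) :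
    S.card * t ^ 2 ≤ 2 * (‖q‖ ^ 2 * β) := by
  rcases S.eq_empty_or_nonempty with rfl | hS
  · simp only [Finset.card_empty, Nat.cast_zero, zero_mul]
    positivity
  have hcard : (0 : ℝ) < S.card := by exact_mod_cast hS.card_pos
  set a : ι → ℝ := fun i => SignType.sign (inner ℝ q (g i))
  have ha : ∀ i, |a i| ≤ 1 := fun i => by
    rcases SignType.trichotomy (SignType.sign (inner ℝ q (g i))) with h | h | h <;>
      simp [a, h]
  have hsum : S.card * t ≤ inner ℝ q (∑ i ∈ S, a i • g i) := by
    rw [inner_sum, ← nsmul_eq_mul, ← Finset.sum_const]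
    refine Finset.sum_le_sum fun i hi => ?_
    rw [real_inner_smul_right, sign_mul_self]
    exact hq i hi
  have hsq : (S.card * t) ^ 2 ≤ ‖q‖ ^ 2 * (S.card * β + S.card ^ 2 * τ) :=
    calc (S.card * t) ^ 2 ≤ (‖q‖ * ‖∑ i ∈ S, a i • g i‖) ^ 2 := by
          exact pow_le_pow_left₀ (by positivity) (hsum.trans (real_inner_le_norm _ _)) 2
      _ ≤ ‖q‖ ^ 2 * (S.card * β + S.card ^ 2 * τ) := by
          rw [mul_pow]
          gcongr
          exact norm_sq_sum_smul_le hτ0 hβ hτ ha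
  refine le_of_mul_le_mul_left ?_ hcard
  nlinarith [mul_le_mul_of_nonneg_left hqτ (sq_nonneg (S.card : ℝ))]

end AlmostOrthogonal

section SquareIntegrable

variable {X : Type*} [MeasurableSpace X] {μ : Measure X} {f g : X → ℝ}

theorem inner_toLp_two (hf : MemLp f 2 μ) (hg : MemLp g 2 μ) :
    inner ℝ (hf.toLp f) (hg.toLp g) = ∫ x, f x * g x ∂μ := by
  rw [L2.inner_def]
  refine integral_congr_ae ?_
  filter_upwards [hf.coeFn_toLp, hg.coeFn_toLp] with x hfx hgx
  rw [hfx, hgx, Real.inner_apply]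

theorem norm_sq_toLp_two (hf : MemLp f 2 μ) : ‖hf.toLp f‖ ^ 2 = ∫ x, f x ^ 2 ∂μ := by
  simp only [← real_inner_self_eq_norm_sq (hf.toLp f), inner_toLp_two, sq]

theorem sq_integral_mul_le (hf : MemLp f 2 μ) (hg : MemLp g 2 μ) :
    (∫ x, f x * g x ∂μ) ^ 2 ≤ (∫ x, f x ^ 2 ∂μ) * ∫ x, g x ^ 2 ∂μ := by
  rw [← inner_toLp_two hf hg, ← norm_sq_toLp_two hf, ← norm_sq_toLp_two hg, ← mul_pow]
  exact sq_le_sq' (neg_le_of_abs_le (abs_real_inner_le_norm _ _)) (real_inner_le_norm _ _)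

theorem memLp_two_of_abs_le [IsFiniteMeasure μ] (hf : Measurable f) {c : ℝ}
    (hc : ∀ x, |f x| ≤ c) : MemLp f 2 μ :=
  MemLp.of_bound hf.aestronglyMeasurable c (.of_forall hc)

theorem integral_sq_le_of_abs_le [IsProbabilityMeasure μ] (hf : Measurable f) {c : ℝ}
    (hc : ∀ x, |f x| ≤ c) : ∫ x, f x ^ 2 ∂μ ≤ c ^ 2 := by
  calc ∫ x, f x ^ 2 ∂μ ≤ ∫ _, c ^ 2 ∂μ :=
        integral_mono (memLp_two_of_abs_le hf hc).integrable_sq (integrable_const _)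
          fun x => sq_le_sq.2 ((hc x).trans (le_abs_self c))
    _ = c ^ 2 := by simp

end SquareIntegrable

/-! ### Statistical queries on perturbations of a distribution -/

/-- `g` is a relative perturbation of `μ`: the measure with density `1 + g` with respect to `μ` has
the same mass as `μ`. The bound `1 / 2` keeps it comparable with `μ`. -/
structure IsPerturbation {X : Type*} [MeasurableSpace X] (μ : Measure X) (g : X → ℝ) : Prop where
  measurable : Measurable g
  abs_le_half : ∀ x, |g x| ≤ 1 / 2
  integral_eq_zero : ∫ x, g x ∂μ = 0

/-- The measure with density `1 + g` with respect to `μ`. -/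
noncomputable def perturb {X : Type*} [MeasurableSpace X] (μ : Measure X) (g : X → ℝ) : Measure X :=
  μ.withDensity fun x => ENNReal.ofReal (1 + g x)

section Perturbation

variable {X : Type*} [MeasurableSpace X] {μ : Measure X} {g : X → ℝ}

theorem Query.abs_fn_le_one (q : Query X) (x : X) : |q.fn x| ≤ 1 :=
  abs_le.2 (q.bounded_fn x)

theorem Query.memLp_two [IsFiniteMeasure μ] (q : Query X) : MemLp q.fn 2 μ :=
  memLp_two_of_abs_le q.measurable_fn q.abs_fn_le_one

theorem IsPerturbation.half_le_one_add (hg : IsPerturbation μ g) (x : X) : 1 / 2 ≤ 1 + g x := by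
  linarith [neg_le_of_abs_le (hg.abs_le_half x)]

theorem IsPerturbation.memLp_two [IsFiniteMeasure μ] (hg : IsPerturbation μ g) : MemLp g 2 μ :=
  memLp_two_of_abs_le hg.measurable hg.abs_le_half

theorem IsPerturbation.integral_sq_le [IsProbabilityMeasure μ] (hg : IsPerturbation μ g) :
    ∫ x, g x ^ 2 ∂μ ≤ 1 / 4 :=
  (integral_sq_le_of_abs_le hg.measurable hg.abs_le_half).trans_eq (by norm_num)

theorem IsPerturbation.integral_perturb (hg : IsPerturbation μ g) (f : X → ℝ) :
    ∫ x, f x ∂(perturb μ g) = ∫ x, (1 + g x) * f x ∂μ := by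
  have hgm := hg.measurable
  rw [perturb, integral_withDensity_eq_integral_toReal_smul (by fun_prop)
    (.of_forall fun x => ENNReal.ofReal_lt_top)]
  refine integral_congr_ae (.of_forall fun x => ?_)
  simp only [smul_eq_mul]
  rw [ENNReal.toReal_ofReal (by linarith [hg.half_le_one_add x])]

theorem IsPerturbation.isProbabilityMeasure_perturb [IsProbabilityMeasure μ]
    (hg : IsPerturbation μ g) : IsProbabilityMeasure (perturb μ g) := by
  have hint : Integrable g μ := hg.memLp_two.integrable one_le_two
  constructor
  rw [perturb, withDensity_apply _ .univ, Measure.restrict_univ,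
    ← ofReal_integral_eq_lintegral_ofReal (f := fun x => 1 + g x) ((integrable_const 1).add hint)
      (.of_forall fun x => one_half_pos.le.trans (hg.half_le_one_add x)),
    integral_add (integrable_const _) hint, hg.integral_eq_zero]
  simp

theorem IsPerturbation.integral_perturb_sub [IsProbabilityMeasure μ] (hg : IsPerturbation μ g)
    {f : X → ℝ} (hf : MemLp f 2 μ) :
    ∫ x, f x ∂(perturb μ g) - ∫ x, f x ∂μ = ∫ x, f x * g x ∂μ := by
  have hfg : Integrable (fun x => f x * g x) μ := hf.integrable_mul hg.memLp_two
  have hsplit : (fun x => (1 + g x) * f x) = fun x => f x + f x * g x := by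
    funext x
    ring
  rw [hg.integral_perturb, hsplit, integral_add (hf.integrable one_le_two) hfg, add_sub_cancel_left]

theorem IsPerturbation.integral_mul_eq_covariance [IsProbabilityMeasure μ]
    (hg : IsPerturbation μ g) {f : X → ℝ} (hf : MemLp f 2 μ) :
    ∫ x, f x * g x ∂μ = cov[f, g; μ] := by
  rw [covariance_eq_sub hf hg.memLp_two, hg.integral_eq_zero, mul_zero, sub_zero]
  rfl

theorem IsPerturbation.integral_centered_mul (hg : IsPerturbation μ g) (f : X → ℝ) :
    ∫ x, (f x - ∫ y, f y ∂μ) * g x ∂μ = cov[f, g; μ] := by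
  rw [covariance, hg.integral_eq_zero]
  simp only [sub_zero]

theorem IsPerturbation.variance_le_two_mul [IsProbabilityMeasure μ] (hg : IsPerturbation μ g)
    {f : X → ℝ} (hf : Measurable f) {b : ℝ} (hb : ∀ x, |f x| ≤ b) :
    variance f μ ≤ 2 * variance f (perturb μ g) := by
  have := hg.isProbabilityMeasure_perturb
  have hgm := hg.measurable
  set c := ∫ x, f x ∂(perturb μ g) with hc
  have hfc : Measurable fun x => f x - c := hf.sub_const c
  have hint : Integrable (fun x => (f x - c) ^ 2) μ :=
    (memLp_two_of_abs_le hfc fun x =>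
      (abs_sub _ _).trans (add_le_add_left (hb x) |c|)).integrable_sq
  have hint' : Integrable (fun x => (1 + g x) * (f x - c) ^ 2) μ := by
    refine hint.bdd_mul (c := 3 / 2) (by fun_prop) (.of_forall fun x => ?_)
    have := abs_le.1 (hg.abs_le_half x)
    rw [Real.norm_eq_abs, abs_le]
    constructor <;> linarith
  calc variance f μ = variance (fun x => f x - c) μ :=
        (variance_sub_const hf.aestronglyMeasurable c).symm
    _ ≤ ∫ x, (f x - c) ^ 2 ∂μ := variance_le_expectation_sq hfc.aestronglyMeasurable
    _ ≤ ∫ x, 2 * ((1 + g x) * (f x - c) ^ 2) ∂μ :=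
        integral_mono hint (hint'.const_mul 2) fun x => by
          nlinarith [sq_nonneg (f x - c), hg.half_le_one_add x]
    _ = 2 * variance f (perturb μ g) := by
        rw [integral_const_mul, variance_eq_integral hf.aemeasurable, ← hc, hg.integral_perturb]

end Perturbation

/-- The query `q` tells `D` from `μ`: the expectation over `μ` is not a valid answer for `D`. -/
def Query.Distinguishes {X : Type*} [MeasurableSpace X] (q : Query X) (μ D : Measure X) : Prop :=
  q.tolerance D < |∫ x, q.fn x ∂μ - ∫ x, q.fn x ∂D|

section Distinguishes

variable {X : Type*} [MeasurableSpace X] {μ : Measure X} [IsProbabilityMeasure μ]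

theorem Query.tolerance_pos (q : Query X) (D : Measure X) : 0 < q.tolerance D :=
  lt_max_of_lt_left (one_div_pos.2 q.u_pos)

theorem IsPerturbation.tolerance_lt_abs_covariance {g : X → ℝ} (hg : IsPerturbation μ g)
    {q : Query X} (hq : q.Distinguishes μ (perturb μ g)) :
    q.tolerance (perturb μ g) < |cov[q.fn, g; μ]| := by
  rwa [Query.Distinguishes, abs_sub_comm, hg.integral_perturb_sub q.memLp_two,
    hg.integral_mul_eq_covariance q.memLp_two] at hq

theorem IsPerturbation.sqrt_variance_le {g : X → ℝ} (hg : IsPerturbation μ g) {q : Query X}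
    (hq : q.Distinguishes μ (perturb μ g)) :
    Real.sqrt (variance q.fn μ / (2 * q.u)) ≤ |cov[q.fn, g; μ]| := by
  have hu := q.u_pos
  refine le_trans (le_trans (Real.sqrt_le_sqrt ?_) (le_max_right _ _))
    (hg.tolerance_lt_abs_covariance hq).le
  rw [← div_div]
  gcongr
  linarith [hg.variance_le_two_mul q.measurable_fn q.abs_fn_le_one]

theorem IsPerturbation.variance_pos {g : X → ℝ} (hg : IsPerturbation μ g) {q : Query X}
    (hq : q.Distinguishes μ (perturb μ g)) : 0 < variance q.fn μ := by
  have hcov : cov[q.fn, g; μ] ≠ 0 :=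
    abs_pos.1 ((q.tolerance_pos _).trans (hg.tolerance_lt_abs_covariance hq))
  have hcs := sq_integral_mul_le (q.memLp_two.sub (memLp_const (∫ x, q.fn x ∂μ))) hg.memLp_two
  simp only [Pi.sub_apply, hg.integral_centered_mul,
    ← variance_eq_integral q.measurable_fn.aemeasurable] at hcs
  refine (variance_nonneg _ _).lt_of_ne fun h0 => ?_
  rw [← h0, zero_mul] at hcs
  exact hcs.not_gt (by positivity)

theorem card_mul_sq_le_of_le_abs_integral_mul {ι : Type*} {g : ι → X → ℝ}
    (hg : ∀ i, IsPerturbation μ (g i)) {τ : ℝ} (hτ0 : 0 ≤ τ)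
    (hτ : ∀ i j, i ≠ j → |∫ x, g i x * g j x ∂μ| ≤ τ) {f : X → ℝ} (hf : MemLp f 2 μ) {t : ℝ}
    (ht : 0 ≤ t) {S : Finset ι} (hS : ∀ i ∈ S, t ≤ |∫ x, f x * g i x ∂μ|)
    (hfτ : 2 * ((∫ x, f x ^ 2 ∂μ) * τ) ≤ t ^ 2) :
    S.card * t ^ 2 ≤ (∫ x, f x ^ 2 ∂μ) / 2 := by
  have hgL : ∀ i, MemLp (g i) 2 μ := fun i => (hg i).memLp_two
  have hle := card_mul_sq_le_of_le_abs_inner (S := S) (g := fun i => (hgL i).toLp (g i))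
    (q := hf.toLp f) (β := 1 / 4) (by norm_num) hτ0
    (fun i _ => (norm_sq_toLp_two (hgL i)).trans_le (hg i).integral_sq_le)
    (fun i _ j _ hij => by rw [inner_toLp_two]; exact hτ i j hij) ht
    (fun i hi => by rw [inner_toLp_two]; exact hS i hi) (by rwa [norm_sq_toLp_two])
  rw [norm_sq_toLp_two] at hle
  linarith

theorem card_le_of_distinguishes {ι : Type*} {g : ι → X → ℝ} (hg : ∀ i, IsPerturbation μ (g i))
    {τ : ℝ} (hτ0 : 0 ≤ τ) (hτ : ∀ i j, i ≠ j → |∫ x, g i x * g j x ∂μ| ≤ τ) {q : Query X}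
    (hu : 4 * q.u * τ ≤ 1) {S : Finset ι} (hS : ∀ i ∈ S, q.Distinguishes μ (perturb μ (g i))) :
    S.card ≤ q.u := by
  have hupos := q.u_pos
  rcases S.eq_empty_or_nonempty with rfl | ⟨i₀, hi₀⟩
  · simpa using hupos.le
  have hV := (hg i₀).variance_pos (hS i₀ hi₀)
  set V := variance q.fn μ with hVdef
  have hVint : ∫ x, (q.fn x - ∫ y, q.fn y ∂μ) ^ 2 ∂μ = V :=
    (variance_eq_integral q.measurable_fn.aemeasurable).symm
  have ht : Real.sqrt (V / (2 * q.u)) ^ 2 = V / (2 * q.u) := Real.sq_sqrt (by positivity)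
  have hcard := card_mul_sq_le_of_le_abs_integral_mul hg hτ0 hτ (S := S)
    (q.memLp_two.sub (memLp_const (∫ x, q.fn x ∂μ))) (Real.sqrt_nonneg (V / (2 * q.u)))
    (fun i hi => ((hg i).sqrt_variance_le (hS i hi)).trans_eq
      (congrArg _ ((hg i).integral_centered_mul _).symm)) (by
    simp only [Pi.sub_apply, hVint, ht]
    rw [le_div_iff₀ (by positivity)]
    nlinarith)
  simp only [Pi.sub_apply, hVint, ht] at hcard
  have hscale : S.card * (V / (2 * q.u)) = S.card / q.u * (V / 2) := by
    field_simp
  rw [hscale] at hcard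
  exact (div_le_one hupos).1 (le_of_mul_le_mul_right (by linarith) (half_pos hV))

end Distinguishes

/-! ### Running an SQ algorithm against many oracles -/

theorem exists_result_eq {X Y ι : Type*} [MeasurableSpace X]
    (O₀ : Query X → ℝ) (O : ι → Query X → ℝ) (U : ℝ) (M : ℕ)
    (hM : ∀ q : Query X, q.u < U → ∃ S : Finset ι, S.card ≤ M ∧ ∀ i ∉ S, O i q = O₀ q)
    (N : ℕ) (T : SQAlg X Y) :
    ∃ S : Finset ι, S.card ≤ N * M ∧ ∀ i ∉ S, (T.queries (O i)).length ≤ N →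
      (∀ q ∈ T.queries (O i), q.u < U) → T.result (O i) = T.result O₀ := by
  classical
  induction N generalizing T with
  | zero =>
    refine ⟨∅, by simp, fun i _ hlen _ => ?_⟩
    cases T with
    | output y => rfl
    | query q next => simp [SQAlg.queries] at hlen
  | succ N ih =>
    cases T with
    | output y => exact ⟨∅, by simp, fun i _ _ _ => rfl⟩
    | query q next =>
      by_cases hq : q.u < U
      · obtain ⟨S₁, hS₁, hagree⟩ := hM q hq
        obtain ⟨S₂, hS₂, hresult⟩ := ih (next (O₀ q))
        refine ⟨S₁ ∪ S₂, ?_, fun i hi hlen hu => ?_⟩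
        · calc (S₁ ∪ S₂).card ≤ S₁.card + S₂.card := Finset.card_union_le _ _
            _ ≤ M + N * M := by gcongr
            _ = (N + 1) * M := by ring
        · rw [Finset.mem_union, not_or] at hi
          simp only [SQAlg.queries, List.length_cons, List.mem_cons, forall_eq_or_imp,
            hagree i hi.1] at hlen hu
          simp only [SQAlg.result, hagree i hi.1]
          exact hresult i hi.2 (by omega) hu.2
      · exact ⟨∅, by simp, fun i _ _ hu => absurd (hu q (by simp [SQAlg.queries])) hq⟩

theorem exists_card_le_forall_notMem {Ω ι : Type*} [MeasurableSpace Ω] [Fintype ι] {P : Measure Ω}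
    [IsProbabilityMeasure P] {F : ι → Set Ω} {p : ℝ} (hF : ∀ i, P.real (F i) ≤ p) {G : Ω → Prop}
    (hG : ∀ᵐ ω ∂P, G ω) :
    ∃ ω, G ω ∧ ∃ S : Finset ι, S.card ≤ Fintype.card ι * p ∧ ∀ i ∉ S, ω ∉ F i := by
  classical
  set M : ι → Set Ω := fun i => toMeasurable P (F i)
  have hM : ∀ i, MeasurableSet (M i) := fun i => measurableSet_toMeasurable _ _
  have hint : ∀ i, Integrable ((M i).indicator (1 : Ω → ℝ)) P := fun i =>
    (integrable_const (1 : ℝ)).indicator (hM i)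
  have hmean : ∫ ω, ∑ i, (M i).indicator (1 : Ω → ℝ) ω ∂P ≤ Fintype.card ι * p := by
    rw [integral_finsetSum _ fun i _ => hint i]
    calc ∑ i, ∫ ω, (M i).indicator (1 : Ω → ℝ) ω ∂P ≤ ∑ _ : ι, p := by
          refine Finset.sum_le_sum fun i _ => ?_
          rw [integral_indicator_one (hM i), measureReal_def, measure_toMeasurable]
          exact hF i
      _ = Fintype.card ι * p := by simp
  obtain ⟨ω, hω, hle⟩ := exists_notMem_null_le_integral
    (integrable_finsetSum Finset.univ fun i _ => hint i) hG
  refine ⟨ω, of_not_not hω, Finset.univ.filter fun i => ω ∈ M i, ?_, fun i hi hωi => hi ?_⟩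
  · refine (Eq.le ?_).trans (hle.trans hmean)
    simp [Set.indicator_apply]
  · simpa using subset_toMeasurable P (F i) hωi

/-! ### Many almost orthogonal directions -/

theorem exists_pairwise_not_of_card_filter_le {α : Type*} [Fintype α] {R : α → α → Prop}
    [DecidableRel R] (hrefl : ∀ a, R a a) (hsymm : ∀ a b, R a b → R b a) {N : ℝ}
    (hN : ∀ a, ((Finset.univ.filter (R a)).card : ℝ) ≤ N) :
    ∃ V : Finset α, (V : Set α).Pairwise (fun a b => ¬ R a b) ∧ Fintype.card α ≤ V.card * N := by
  classical
  obtain ⟨V, hV, hmax⟩ := Finset.exists_max_image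
    (Finset.univ.filter fun V : Finset α => (V : Set α).Pairwise fun a b => ¬ R a b) Finset.card
    ⟨∅, by simp⟩
  have hpair := (Finset.mem_filter.1 hV).2
  refine ⟨V, hpair, ?_⟩
  have hcover : (Finset.univ : Finset α) ⊆ V.biUnion fun a => Finset.univ.filter (R a) := by
    intro b _
    by_contra hb
    simp only [Finset.mem_biUnion, Finset.mem_filter, Finset.mem_univ, true_and, not_exists,
      not_and] at hb
    have hinsert : ((insert b V : Finset α) : Set α).Pairwise fun a b => ¬ R a b := by
      rw [Finset.coe_insert]
      exact hpair.insert fun a ha _ => ⟨fun h => hb a ha (hsymm _ _ h), hb a ha⟩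
    have hle := hmax _ (Finset.mem_filter.2 ⟨Finset.mem_univ _, hinsert⟩)
    rw [Finset.card_insert_of_notMem fun h => hb b h (hrefl b)] at hle
    omega
  calc (Fintype.card α : ℝ) ≤ (V.biUnion fun a => Finset.univ.filter (R a)).card := by
        exact_mod_cast Finset.card_le_card hcover
    _ ≤ ∑ a ∈ V, ((Finset.univ.filter (R a)).card : ℝ) := by
        exact_mod_cast Finset.card_biUnion_le
    _ ≤ ∑ _ ∈ V, N := Finset.sum_le_sum fun a _ => hN a
    _ = V.card * N := by simp

/-- The sum of the coordinates of a sign vector. For two sign vectors, `signSum (σ * τ)` is their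
inner product. -/
def signSum {ι : Type*} [Fintype ι] (σ : ι → ℤˣ) : ℝ := ∑ i, ((σ i : ℤ) : ℝ)

section SignVectors

variable {ι : Type*} [Fintype ι]

theorem signSum_mul_self (σ : ι → ℤˣ) : signSum (σ * σ) = Fintype.card ι := by
  simp [signSum]

theorem card_filter_le_abs_signSum_mul [DecidableEq ι] (σ : ι → ℤˣ) (s : ℝ) :
    (Finset.univ.filter fun τ : ι → ℤˣ => s ≤ |signSum (σ * τ)|).card
      = (Finset.univ.filter fun τ : ι → ℤˣ => s ≤ |signSum τ|).card :=
  Finset.card_equiv (Equiv.mulLeft σ) fun τ => by simp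

theorem sum_exp_mul_signSum [DecidableEq ι] (t : ℝ) :
    ∑ σ : ι → ℤˣ, Real.exp (t * signSum σ) = (2 * Real.cosh t) ^ Fintype.card ι := by
  have hunits : ∑ u : ℤˣ, Real.exp (t * ((u : ℤ) : ℝ)) = 2 * Real.cosh t := by
    rw [Real.cosh_eq, UnitsInt.univ, Finset.sum_pair (by decide)]
    simp only [Units.val_one, Int.cast_one, mul_one, Units.val_neg, Int.cast_neg, mul_neg]
    ring
  have hprod := Finset.prod_univ_sum (fun _ : ι => (Finset.univ : Finset ℤˣ))
    fun _ u => Real.exp (t * ((u : ℤ) : ℝ))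
  simp only [hunits, Finset.prod_const, Finset.card_univ, Fintype.piFinset_univ] at hprod
  simp only [signSum, Finset.mul_sum, Real.exp_sum, hprod]

theorem sum_exp_mul_signSum_le [DecidableEq ι] (t : ℝ) :
    ∑ σ : ι → ℤˣ, Real.exp (t * signSum σ)
      ≤ 2 ^ Fintype.card ι * Real.exp (Fintype.card ι * t ^ 2 / 2) := by
  rw [sum_exp_mul_signSum, mul_pow, mul_div_assoc, Real.exp_nat_mul]
  gcongr
  exact Real.cosh_le_exp_half_sq t

theorem card_filter_le_abs_signSum_le [DecidableEq ι] {r : ℝ} (hr : 0 ≤ r) :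
    ((Finset.univ.filter fun σ : ι → ℤˣ => r * Fintype.card ι ≤ |signSum σ|).card : ℝ)
      ≤ 2 ^ Fintype.card ι * (2 * Real.exp (-(Fintype.card ι * r ^ 2 / 2))) := by
  have hchernoff : ∀ σ : ι → ℤˣ, (if r * Fintype.card ι ≤ |signSum σ| then 1 else 0)
      ≤ (Real.exp (r * signSum σ) + Real.exp (-r * signSum σ))
        * Real.exp (-(Fintype.card ι * r ^ 2)) := by
    intro σ
    split_ifs with h
    · rw [add_mul, ← Real.exp_add, ← Real.exp_add]
      rcases le_abs.1 h with h | h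
      · refine le_add_of_le_of_nonneg (Real.one_le_exp ?_) (Real.exp_pos _).le
        nlinarith
      · refine le_add_of_nonneg_of_le (Real.exp_pos _).le (Real.one_le_exp ?_)
        nlinarith
    · positivity
  calc ((Finset.univ.filter fun σ : ι → ℤˣ => r * Fintype.card ι ≤ |signSum σ|).card : ℝ)
      = ∑ σ : ι → ℤˣ, if r * Fintype.card ι ≤ |signSum σ| then (1 : ℝ) else 0 := by simp
    _ ≤ (∑ σ : ι → ℤˣ, Real.exp (r * signSum σ) + ∑ σ : ι → ℤˣ, Real.exp (-r * signSum σ))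
        * Real.exp (-(Fintype.card ι * r ^ 2)) := by
        rw [← Finset.sum_add_distrib, Finset.sum_mul]
        exact Finset.sum_le_sum fun σ _ => hchernoff σ
    _ ≤ (2 ^ Fintype.card ι * Real.exp (Fintype.card ι * r ^ 2 / 2)
        + 2 ^ Fintype.card ι * Real.exp (Fintype.card ι * (-r) ^ 2 / 2))
        * Real.exp (-(Fintype.card ι * r ^ 2)) := by
        gcongr <;> exact sum_exp_mul_signSum_le _
    _ = 2 ^ Fintype.card ι * (2 * Real.exp (-(Fintype.card ι * r ^ 2 / 2))) := by
        have hexp : Real.exp (-(Fintype.card ι * r ^ 2 / 2))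
            = Real.exp (Fintype.card ι * r ^ 2 / 2) * Real.exp (-(Fintype.card ι * r ^ 2)) := by
          rw [← Real.exp_add]
          ring_nf
        rw [hexp, neg_sq]
        ring

/-- The unit vector with the signs `σ`. -/
noncomputable def signVector (σ : ι → ℤˣ) : EuclideanSpace ℝ ι :=
  WithLp.toLp 2 fun i => ((σ i : ℤ) : ℝ) / Real.sqrt (Fintype.card ι)

theorem inner_signVector (σ τ : ι → ℤˣ) :
    inner ℝ (signVector σ) (signVector τ) = signSum (σ * τ) / Fintype.card ι := by
  simp only [signVector, PiLp.inner_apply, Real.inner_apply, signSum, Finset.sum_div]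
  refine Finset.sum_congr rfl fun i _ => ?_
  rw [div_mul_div_comm, Real.mul_self_sqrt (Nat.cast_nonneg _)]
  simp

theorem norm_signVector [Nonempty ι] (σ : ι → ℤˣ) : ‖signVector σ‖ = 1 := by
  have hcard : (Fintype.card ι : ℝ) ≠ 0 := Nat.cast_ne_zero.2 Fintype.card_ne_zero
  rw [← sq_eq_sq₀ (norm_nonneg _) zero_le_one, ← real_inner_self_eq_norm_sq, inner_signVector,
    signSum_mul_self, div_self hcard, one_pow]

theorem exists_almost_orthogonal [Nonempty ι] {r : ℝ} (hr : 0 ≤ r) (hr1 : r ≤ 1) :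
    ∃ (m : ℕ) (v : Fin m → EuclideanSpace ℝ ι),
      Real.exp (Fintype.card ι * r ^ 2 / 2) / 2 ≤ m ∧ (∀ i, ‖v i‖ = 1) ∧
      ∀ i j, i ≠ j → |inner ℝ (v i) (v j)| ≤ r := by
  classical
  have hcard : (0 : ℝ) < Fintype.card ι := by exact_mod_cast Fintype.card_pos
  obtain ⟨V, hV, hVcard⟩ := exists_pairwise_not_of_card_filter_le
    (R := fun σ τ : ι → ℤˣ => r * Fintype.card ι ≤ |signSum (σ * τ)|)
    (N := 2 ^ Fintype.card ι * (2 * Real.exp (-(Fintype.card ι * r ^ 2 / 2))))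
    (fun σ => by
      rw [signSum_mul_self, Nat.abs_cast]
      exact mul_le_of_le_one_left hcard.le hr1)
    (fun σ τ h => by rwa [mul_comm τ σ])
    (fun σ => by
      rw [card_filter_le_abs_signSum_mul]
      exact card_filter_le_abs_signSum_le hr)
  refine ⟨V.card, fun i => signVector (V.equivFin.symm i), ?_, fun i => norm_signVector _,
    fun i j hij => ?_⟩
  · have hcube : (Fintype.card (ι → ℤˣ) : ℝ) = 2 ^ Fintype.card ι := by simp
    have hone : (1 : ℝ) ≤ V.card * (2 * Real.exp (-(Fintype.card ι * r ^ 2 / 2))) := by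
      rw [hcube, mul_left_comm] at hVcard
      exact le_of_mul_le_mul_left (by rwa [mul_one]) (by positivity : (0 : ℝ) < 2 ^ Fintype.card ι)
    rw [Real.exp_neg, ← mul_assoc, ← div_eq_mul_inv, one_le_div (Real.exp_pos _)] at hone
    linarith
  · have hne : (V.equivFin.symm i : ι → ℤˣ) ≠ V.equivFin.symm j := fun h =>
      hij (V.equivFin.symm.injective (Subtype.ext h))
    rw [inner_signVector, abs_div, Nat.abs_cast, div_le_iff₀ hcard]
    exact (not_le.1 (hV (V.equivFin.symm i).2 (V.equivFin.symm j).2 hne)).le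

end SignVectors

/-! ### Correlation of functions of two almost orthogonal directions -/

theorem hasSum_exp_mul_exp (a b : ℝ) :
    HasSum (fun p : ℕ × ℕ => a ^ p.1 / p.1.factorial * (b ^ p.2 / p.2.factorial))
      (Real.exp a * Real.exp b) := by
  have hexp : ∀ x : ℝ, HasSum (fun n : ℕ => x ^ n / n.factorial) (Real.exp x) := fun x => by
    rw [Real.exp_eq_exp_ℝ]
    exact NormedSpace.expSeries_div_hasSum_exp x
  exact HasSum.mul (f := fun n : ℕ => a ^ n / n.factorial) (g := fun n : ℕ => b ^ n / n.factorial)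
    (hexp a) (hexp b)
    (summable_mul_of_summable_norm (f := fun n : ℕ => a ^ n / n.factorial)
      (g := fun n : ℕ => b ^ n / n.factorial) (hexp a).summable.norm (hexp b).summable.norm)

/-- The exponents `(i, j)` of the terms `(α x) ^ i * (-β x²) ^ j` of degree `< n` in `x`. -/
def expQuadIndices (n : ℕ) : Finset (ℕ × ℕ) :=
  (Finset.range n ×ˢ Finset.range n).filter fun p => p.1 + 2 * p.2 < n

theorem mem_expQuadIndices {n : ℕ} {p : ℕ × ℕ} :
    p ∈ expQuadIndices n ↔ p.1 + 2 * p.2 < n := by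
  simp only [expQuadIndices, Finset.mem_filter, Finset.mem_product, Finset.mem_range]
  omega

/-- The terms of degree `< n` of the power series of `exp (α x - β x²)`. -/
noncomputable def expQuadTrunc (n : ℕ) (α β x : ℝ) : ℝ :=
  ∑ p ∈ expQuadIndices n,
    (α * x) ^ p.1 / p.1.factorial * ((-(β * x ^ 2)) ^ p.2 / p.2.factorial)

theorem expQuadTrunc_eq_sum_monomials (n : ℕ) (α β x : ℝ) :
    expQuadTrunc n α β x = ∑ p ∈ expQuadIndices n,
      α ^ p.1 / p.1.factorial * ((-β) ^ p.2 / p.2.factorial) * x ^ (p.1 + 2 * p.2) := by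
  refine Finset.sum_congr rfl fun p _ => ?_
  rw [mul_pow, pow_add, pow_mul, ← neg_mul, mul_pow]
  ring

theorem measurable_expQuadTrunc (n : ℕ) (α β : ℝ) : Measurable (expQuadTrunc n α β) := by
  unfold expQuadTrunc
  fun_prop

-- A term of degree `k ≥ n` is `η ^ k ≤ η ^ n` times the same term at `|x| / η`.
theorem abs_exp_sub_expQuadTrunc_le (n : ℕ) (α β x : ℝ) {η : ℝ} (hη : 0 < η) (hη1 : η ≤ 1) :
    |Real.exp (α * x - β * x ^ 2) - expQuadTrunc n α β x|
      ≤ η ^ n * Real.exp (|α| * |x| / η + |β| * x ^ 2 / η ^ 2) := by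
  set f : ℕ × ℕ → ℝ := fun p =>
    (α * x) ^ p.1 / p.1.factorial * ((-(β * x ^ 2)) ^ p.2 / p.2.factorial) with hf
  set g : ℕ × ℕ → ℝ := fun p =>
    (|α| * |x| / η) ^ p.1 / p.1.factorial * ((|β| * x ^ 2 / η ^ 2) ^ p.2 / p.2.factorial) with hg
  have hfull : HasSum f (Real.exp (α * x - β * x ^ 2)) := by
    rw [sub_eq_add_neg, Real.exp_add]
    exact hasSum_exp_mul_exp _ _
  have htrunc : HasSum (fun p => if p ∈ expQuadIndices n then f p else 0)
      (expQuadTrunc n α β x) := by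
    rw [expQuadTrunc, Finset.sum_congr rfl fun p hp => (if_pos hp).symm]
    exact hasSum_sum_of_ne_finset_zero fun p hp => if_neg hp
  have hmajorant : HasSum (fun p => η ^ n * g p)
      (η ^ n * Real.exp (|α| * |x| / η + |β| * x ^ 2 / η ^ 2)) := by
    rw [Real.exp_add]
    exact (hasSum_exp_mul_exp _ _).mul_left _
  have hscale : ∀ p, ‖f p‖ = η ^ (p.1 + 2 * p.2) * g p := fun p => by
    simp only [hf, hg, norm_mul, norm_div, norm_pow, norm_neg, Real.norm_eq_abs, Nat.abs_cast,
      sq_abs]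
    rw [div_pow, div_pow, pow_add, ← pow_mul]
    field_simp
  refine (hfull.sub htrunc).norm_le_of_bounded hmajorant fun p => ?_
  split_ifs with hp
  · rw [sub_self, norm_zero]
    positivity
  · rw [sub_zero, hscale]
    rw [mem_expQuadIndices, not_lt] at hp
    exact mul_le_mul_of_nonneg_right (pow_le_pow_of_le_one hη.le hη1 hp) (by positivity)

theorem integrable_gaussianReal_iff {μ : ℝ} {v : NNReal} (hv : v ≠ 0) {f : ℝ → ℝ} :
    Integrable f (gaussianReal μ v) ↔ Integrable (fun x => gaussianPDFReal μ v x * f x) := by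
  rw [gaussianReal_of_var_ne_zero _ hv, integrable_withDensity_iff_integrable_smul'
    (measurable_gaussianPDF μ v) (.of_forall fun x => gaussianPDF_lt_top)]
  simp [toReal_gaussianPDF]

theorem integrable_pow_gaussianReal (μ : ℝ) (v : NNReal) (n : ℕ) :
    Integrable (fun x => x ^ n) (gaussianReal μ v) := by
  rcases Nat.eq_zero_or_pos n with rfl | hn
  · simp
  have hnorm := (memLp_id_gaussianReal (μ := μ) (v := v) n).integrable_norm_pow hn.ne'
  exact hnorm.mono' (by fun_prop) (.of_forall fun x => by simp)

section ExpSq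

theorem gaussianPDFReal_mul_exp_mul_sq (b x : ℝ) :
    gaussianPDFReal 0 1 x * Real.exp (b * x ^ 2)
      = (Real.sqrt (2 * Real.pi))⁻¹ * Real.exp (-(1 / 2 - b) * x ^ 2) := by
  simp only [gaussianPDFReal, sub_zero, NNReal.coe_one, mul_one, mul_assoc, ← Real.exp_add]
  ring_nf

variable {b : ℝ} (hb : b < 1 / 2)

include hb

theorem integrable_exp_mul_sq_gaussianReal :
    Integrable (fun x => Real.exp (b * x ^ 2)) (gaussianReal 0 1) := by
  rw [integrable_gaussianReal_iff one_ne_zero]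
  simp only [gaussianPDFReal_mul_exp_mul_sq]
  exact (integrable_exp_neg_mul_sq (sub_pos.2 hb)).const_mul _

theorem integral_exp_mul_sq_gaussianReal :
    ∫ x, Real.exp (b * x ^ 2) ∂(gaussianReal 0 1) = (Real.sqrt (1 - 2 * b))⁻¹ := by
  have hb' : 0 < 1 - 2 * b := by linarith
  simp only [integral_gaussianReal_eq_integral_smul one_ne_zero, smul_eq_mul,
    gaussianPDFReal_mul_exp_mul_sq, integral_const_mul, integral_gaussian]
  rw [← Real.sqrt_inv, ← Real.sqrt_inv, ← Real.sqrt_mul (by positivity)]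
  congr 1
  have : 1 / 2 - b ≠ 0 := by linarith
  field_simp

end ExpSq

theorem integrable_expQuadTrunc (n : ℕ) (α β : ℝ) :
    Integrable (expQuadTrunc n α β) (gaussianReal 0 1) := by
  simp only [funext (expQuadTrunc_eq_sum_monomials n α β)]
  exact integrable_finsetSum _ fun p _ => (integrable_pow_gaussianReal _ _ _).const_mul _

section VanishingMoments

variable {φ : ℝ → ℝ} {B : ℝ} {n : ℕ}

theorem integral_mul_expQuadTrunc_eq_zero (hφ : Measurable φ) (hB : ∀ x, |φ x| ≤ B)
    (hmom : ∀ t < n, ∫ x, φ x * x ^ t ∂(gaussianReal 0 1) = 0) (α β : ℝ) :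
    ∫ x, φ x * expQuadTrunc n α β x ∂(gaussianReal 0 1) = 0 := by
  have hint : ∀ t : ℕ, Integrable (fun x => φ x * x ^ t) (gaussianReal 0 1) := fun t =>
    (integrable_pow_gaussianReal 0 1 t).bdd_mul hφ.aestronglyMeasurable (.of_forall hB)
  simp only [expQuadTrunc_eq_sum_monomials, Finset.mul_sum, mul_left_comm (φ _)]
  rw [integral_finsetSum _ fun p _ => (hint _).const_mul _]
  refine Finset.sum_eq_zero fun p hp => ?_
  rw [integral_const_mul, hmom _ (mem_expQuadIndices.1 hp), mul_zero]

theorem abs_integral_mul_exp_le (hφ : Measurable φ) (hB : ∀ x, |φ x| ≤ B)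
    (hmom : ∀ t < n, ∫ x, φ x * x ^ t ∂(gaussianReal 0 1) = 0) (α : ℝ) {β : ℝ} {η : ℝ}
    (hη : 0 < η) (hη1 : η ≤ 1) {g : ℝ → ℝ}
    (hg : ∀ x, Real.exp (|α| * |x| / η + |β| * x ^ 2 / η ^ 2) ≤ g x)
    (hgi : Integrable g (gaussianReal 0 1)) :
    |∫ x, φ x * Real.exp (α * x - β * x ^ 2) ∂(gaussianReal 0 1)|
      ≤ B * η ^ n * ∫ x, g x ∂(gaussianReal 0 1) := by
  have hB0 : 0 ≤ B := (abs_nonneg _).trans (hB 0)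
  have hmeas := measurable_expQuadTrunc n α β
  have hrem : ∀ x, ‖φ x * (Real.exp (α * x - β * x ^ 2) - expQuadTrunc n α β x)‖
      ≤ B * η ^ n * g x := by
    intro x
    rw [norm_mul, mul_assoc]
    refine mul_le_mul (hB x) ?_ (norm_nonneg _) hB0
    refine (abs_exp_sub_expQuadTrunc_le n α β x hη hη1).trans ?_
    gcongr
    exact hg x
  have hremi : Integrable (fun x => φ x * (Real.exp (α * x - β * x ^ 2) - expQuadTrunc n α β x))
      (gaussianReal 0 1) :=
    (hgi.const_mul (B * η ^ n)).mono' (by fun_prop) (.of_forall hrem)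
  have hsplit : ∀ x, φ x * Real.exp (α * x - β * x ^ 2) =
      φ x * (Real.exp (α * x - β * x ^ 2) - expQuadTrunc n α β x)
        + φ x * expQuadTrunc n α β x := fun x => by ring
  simp only [hsplit]
  rw [integral_add hremi
      ((integrable_expQuadTrunc n α β).bdd_mul hφ.aestronglyMeasurable (.of_forall hB)),
    integral_mul_expQuadTrunc_eq_zero hφ hB hmom, add_zero, ← integral_const_mul]
  exact norm_integral_le_of_norm_le (hgi.const_mul _) (.of_forall hrem)

end VanishingMoments

section OrnsteinUhlenbeck

variable {ρ : ℝ}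

theorem map_add_mul_gaussianReal (m s : ℝ) :
    (gaussianReal 0 1).map (fun z => m + s * z)
      = gaussianReal m (NNReal.mk (s ^ 2) (sq_nonneg s)) := by
  have hcomp : (fun z => m + s * z) = (fun y => m + y) ∘ fun z => s * z := rfl
  rw [hcomp, ← Measure.map_map (by fun_prop) (by fun_prop), gaussianReal_map_const_mul,
    gaussianReal_map_const_add, mul_zero, zero_add, mul_one]

theorem gaussianPDFReal_mul_eq (hρ : |ρ| < 1) {v : NNReal} (hv : v = 1 - ρ ^ 2) (x y : ℝ) :
    gaussianPDFReal (ρ * x) v y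
      = (Real.sqrt (1 - ρ ^ 2))⁻¹ * Real.exp (-(ρ ^ 2 / (2 * (1 - ρ ^ 2)) * x ^ 2)) *
        (gaussianPDFReal 0 1 y *
          Real.exp (ρ / (1 - ρ ^ 2) * x * y - ρ ^ 2 / (2 * (1 - ρ ^ 2)) * y ^ 2)) := by
  have hpos : 0 < 1 - ρ ^ 2 := sub_pos.2 ((sq_lt_one_iff_abs_lt_one ρ).2 hρ)
  have hexp : Real.exp (-(y - ρ * x) ^ 2 / (2 * (1 - ρ ^ 2)))
      = Real.exp (-(ρ ^ 2 / (2 * (1 - ρ ^ 2)) * x ^ 2)) * (Real.exp (-y ^ 2 / 2)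
        * Real.exp (ρ / (1 - ρ ^ 2) * x * y - ρ ^ 2 / (2 * (1 - ρ ^ 2)) * y ^ 2)) := by
    rw [← Real.exp_add, ← Real.exp_add]
    congr 1
    field_simp
    ring
  simp only [gaussianPDFReal, hv, NNReal.coe_one, mul_one, sub_zero]
  rw [hexp, Real.sqrt_mul (by positivity), mul_inv]
  ring

-- Mehler's formula: the Gaussian density centred at `ρ x` is tilted against the centred one.
theorem integral_mul_add_sqrt_mul_gaussianReal (hρ : |ρ| < 1) {ψ : ℝ → ℝ} (hψ : Measurable ψ)
    (x : ℝ) :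
    ∫ z, ψ (ρ * x + Real.sqrt (1 - ρ ^ 2) * z) ∂(gaussianReal 0 1)
      = (Real.sqrt (1 - ρ ^ 2))⁻¹ * Real.exp (-(ρ ^ 2 / (2 * (1 - ρ ^ 2)) * x ^ 2)) *
        ∫ y, ψ y * Real.exp (ρ / (1 - ρ ^ 2) * x * y - ρ ^ 2 / (2 * (1 - ρ ^ 2)) * y ^ 2)
          ∂(gaussianReal 0 1) := by
  have hpos : 0 < 1 - ρ ^ 2 := sub_pos.2 ((sq_lt_one_iff_abs_lt_one ρ).2 hρ)
  have hvar : ((NNReal.mk (Real.sqrt (1 - ρ ^ 2) ^ 2) (sq_nonneg _) : NNReal) : ℝ) = 1 - ρ ^ 2 :=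
    Real.sq_sqrt hpos.le
  have hvar0 : (NNReal.mk (Real.sqrt (1 - ρ ^ 2) ^ 2) (sq_nonneg _) : NNReal) ≠ 0 :=
    fun h => hpos.ne' (by rw [← hvar, h, NNReal.coe_zero])
  rw [← integral_map (φ := fun z => ρ * x + Real.sqrt (1 - ρ ^ 2) * z) (f := ψ) (by fun_prop)
      hψ.aestronglyMeasurable, map_add_mul_gaussianReal,
    integral_gaussianReal_eq_integral_smul hvar0,
    integral_gaussianReal_eq_integral_smul one_ne_zero, ← integral_const_mul]
  refine integral_congr_ae (.of_forall fun y => ?_)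
  simp only [smul_eq_mul, gaussianPDFReal_mul_eq hρ hvar]
  ring

theorem mehler_exponent_le {r : ℝ} (hr : 0 < r) (hr8 : r ≤ 1 / 8) (hρ : |ρ| ≤ r) (x y : ℝ) :
    |ρ / (1 - ρ ^ 2) * x| * |y| / (4 * r)
        + |ρ ^ 2 / (2 * (1 - ρ ^ 2))| * y ^ 2 / (4 * r) ^ 2
      ≤ 1 / 4 * x ^ 2 + 1 / 4 * y ^ 2 := by
  have hρ2 : ρ ^ 2 ≤ r ^ 2 := sq_le_sq' (abs_le.1 hρ).1 (abs_le.1 hρ).2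
  have hpos : 63 / 64 ≤ 1 - ρ ^ 2 := by nlinarith
  have hlin : |ρ / (1 - ρ ^ 2)| ≤ 64 / 63 * r := by
    rw [abs_div, abs_of_pos (by linarith : 0 < 1 - ρ ^ 2), div_le_iff₀ (by linarith)]
    nlinarith
  have hquad : |ρ ^ 2 / (2 * (1 - ρ ^ 2))| ≤ 32 / 63 * r ^ 2 := by
    rw [abs_of_nonneg (by positivity), div_le_iff₀ (by positivity)]
    nlinarith [sq_nonneg r]
  have hx : |ρ / (1 - ρ ^ 2) * x| * |y| / (4 * r) ≤ 16 / 63 * (|x| * |y|) := by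
    rw [abs_mul, div_le_iff₀ (by positivity)]
    linarith [mul_le_mul_of_nonneg_right hlin (mul_nonneg (abs_nonneg x) (abs_nonneg y))]
  have hy : |ρ ^ 2 / (2 * (1 - ρ ^ 2))| * y ^ 2 / (4 * r) ^ 2 ≤ 2 / 63 * y ^ 2 := by
    rw [div_le_iff₀ (by positivity)]
    linarith [mul_le_mul_of_nonneg_right hquad (sq_nonneg y)]
  have hamgm := two_mul_le_add_sq |x| |y|
  rw [sq_abs, sq_abs] at hamgm
  linarith [sq_nonneg x, sq_nonneg y]

theorem abs_integral_mul_add_sqrt_mul_le {r : ℝ} (hr : 0 < r) (hr8 : r ≤ 1 / 8) (hρ : |ρ| ≤ r)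
    {ψ : ℝ → ℝ} (hψ : Measurable ψ) {B : ℝ} (hB : ∀ x, |ψ x| ≤ B) {n : ℕ}
    (hmom : ∀ t < n, ∫ x, ψ x * x ^ t ∂(gaussianReal 0 1) = 0) (x : ℝ) :
    |∫ z, ψ (ρ * x + Real.sqrt (1 - ρ ^ 2) * z) ∂(gaussianReal 0 1)|
      ≤ 2 * Real.sqrt 2 * B * (4 * r) ^ n * Real.exp (1 / 4 * x ^ 2) := by
  have hρ2 : ρ ^ 2 ≤ r ^ 2 := sq_le_sq' (abs_le.1 hρ).1 (abs_le.1 hρ).2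
  have hpos : 63 / 64 ≤ 1 - ρ ^ 2 := by nlinarith
  have hinv : (Real.sqrt (1 - ρ ^ 2))⁻¹ ≤ 2 := by
    rw [inv_le_comm₀ (Real.sqrt_pos.2 (by linarith)) two_pos]
    exact Real.le_sqrt_of_sq_le (by linarith)
  have hdamp : Real.exp (-(ρ ^ 2 / (2 * (1 - ρ ^ 2)) * x ^ 2)) ≤ 1 :=
    Real.exp_le_one_iff.2 (neg_nonpos.2 (by positivity))
  have htilt := abs_integral_mul_exp_le hψ hB hmom (ρ / (1 - ρ ^ 2) * x)
    (β := ρ ^ 2 / (2 * (1 - ρ ^ 2))) (η := 4 * r) (by positivity) (by linarith)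
    (g := fun y => Real.exp (1 / 4 * x ^ 2) * Real.exp (1 / 4 * y ^ 2))
    (fun y => by
      rw [← Real.exp_add]
      exact Real.exp_le_exp.2 (mehler_exponent_le hr hr8 hρ x y))
    ((integrable_exp_mul_sq_gaussianReal (by norm_num)).const_mul _)
  have hsqrt : (Real.sqrt (1 - 2 * (1 / 4)))⁻¹ = Real.sqrt 2 := by
    rw [← Real.sqrt_inv]
    norm_num
  rw [integral_const_mul, integral_exp_mul_sq_gaussianReal (by norm_num), hsqrt] at htilt
  rw [integral_mul_add_sqrt_mul_gaussianReal (by linarith) hψ, abs_mul,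
    abs_of_nonneg (by positivity)]
  calc _ ≤ 2 * 1 * (B * (4 * r) ^ n * (Real.exp (1 / 4 * x ^ 2) * Real.sqrt 2)) := by gcongr
    _ = _ := by ring

end OrnsteinUhlenbeck

section Directions

variable {E : Type*} [NormedAddCommGroup E] [InnerProductSpace ℝ E] {v w : E}

theorem exists_orthogonal_decomposition (hv : ‖v‖ = 1) (hw : ‖w‖ = 1) (hvw : |inner ℝ v w| < 1) :
    ∃ e : E, ‖e‖ = 1 ∧ inner ℝ v e = 0 ∧
      w = inner ℝ v w • v + Real.sqrt (1 - inner ℝ v w ^ 2) • e := by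
  set ρ : ℝ := inner ℝ v w with hρ
  have hpos : 0 < 1 - ρ ^ 2 := sub_pos.2 ((sq_lt_one_iff_abs_lt_one ρ).2 hvw)
  have hs : 0 < Real.sqrt (1 - ρ ^ 2) := Real.sqrt_pos.2 hpos
  have horth : inner ℝ v (w - ρ • v) = 0 := by
    rw [inner_sub_right, real_inner_smul_right, real_inner_self_eq_norm_sq, hv, ← hρ]
    ring
  have hnorm : ‖w - ρ • v‖ = Real.sqrt (1 - ρ ^ 2) := by
    refine (Real.sqrt_eq_iff_eq_sq hpos.le (norm_nonneg _)).2 ?_ |>.symm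
    rw [norm_sub_sq_real, norm_smul, real_inner_smul_right, real_inner_comm, ← hρ, hv, hw,
      Real.norm_eq_abs, mul_one, sq_abs]
    ring
  refine ⟨(Real.sqrt (1 - ρ ^ 2))⁻¹ • (w - ρ • v), ?_, ?_, ?_⟩
  · rw [norm_smul, hnorm, norm_inv, Real.norm_of_nonneg hs.le, inv_mul_cancel₀ hs.ne']
  · rw [real_inner_smul_right, horth, mul_zero]
  · rw [smul_inv_smul₀ hs.ne', add_sub_cancel]

variable [FiniteDimensional ℝ E] [MeasurableSpace E] [BorelSpace E]

theorem map_inner_stdGaussian (hv : ‖v‖ = 1) :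
    (stdGaussian E).map (fun x => inner ℝ v x) = gaussianReal 0 1 := by
  have hlaw := ((IsGaussian.hasGaussianLaw_id (μ := stdGaussian E)).map_fun
    (innerSL ℝ v)).map_eq_gaussianReal
  have hvar := variance_dual_stdGaussian (innerSL ℝ v)
  rw [innerSL_apply_norm, hv] at hvar
  simp only [id] at hlaw
  rw [integral_strongDual_stdGaussian, hvar] at hlaw
  simpa using hlaw

theorem map_inner_inner_stdGaussian (hv : ‖v‖ = 1) (hw : ‖w‖ = 1) (hvw : inner ℝ v w = 0) :
    (stdGaussian E).map (fun x => (inner ℝ v x, inner ℝ w x))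
      = (gaussianReal 0 1).prod (gaussianReal 0 1) := by
  have hlaw := (IsGaussian.hasGaussianLaw_id (μ := stdGaussian E)).map_fun
    ((innerSL ℝ v).prod (innerSL ℝ w))
  simp only [id, ContinuousLinearMap.prod_apply, innerSL_apply_apply] at hlaw
  have hcov : cov[fun x => inner ℝ v x, fun x => inner ℝ w x; stdGaussian E] = 0 := by
    rw [← covarianceBilin_apply_eq_cov IsGaussian.memLp_two_id, covarianceBilin_stdGaussian,
      innerSL_apply_apply, hvw]
  have hindep := hlaw.indepFun_of_covariance_eq_zero hcov
  rwa [indepFun_iff_map_prod_eq_prod_map_map (by fun_prop) (by fun_prop),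
    map_inner_stdGaussian hv, map_inner_stdGaussian hw] at hindep

variable {φ ψ : ℝ → ℝ} {A B : ℝ}

theorem integral_mul_inner_inner (hv : ‖v‖ = 1) (hw : ‖w‖ = 1) (hvw : |inner ℝ v w| < 1)
    (hφ : Measurable φ) (hψ : Measurable ψ) (hA : ∀ x, |φ x| ≤ A) (hB : ∀ x, |ψ x| ≤ B) :
    ∫ x, φ (inner ℝ v x) * ψ (inner ℝ w x) ∂(stdGaussian E)
      = ∫ x, φ x * ∫ z, ψ (inner ℝ v w * x + Real.sqrt (1 - (inner ℝ v w) ^ 2) * z)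
          ∂(gaussianReal 0 1) ∂(gaussianReal 0 1) := by
  obtain ⟨e, he, hve, hwe⟩ := exists_orthogonal_decomposition hv hw hvw
  set ρ : ℝ := inner ℝ v w
  set s := Real.sqrt (1 - ρ ^ 2)
  have hF : Measurable fun p : ℝ × ℝ => φ p.1 * ψ (ρ * p.1 + s * p.2) := by fun_prop
  have hFint : Integrable (fun p : ℝ × ℝ => φ p.1 * ψ (ρ * p.1 + s * p.2))
      ((gaussianReal 0 1).prod (gaussianReal 0 1)) := by
    refine Integrable.of_bound hF.aestronglyMeasurable (A * B) (.of_forall fun p => ?_)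
    rw [norm_mul]
    exact mul_le_mul (hA _) (hB _) (norm_nonneg _) ((abs_nonneg _).trans (hA 0))
  calc ∫ x, φ (inner ℝ v x) * ψ (inner ℝ w x) ∂(stdGaussian E)
      = ∫ x, (fun p : ℝ × ℝ => φ p.1 * ψ (ρ * p.1 + s * p.2)) (inner ℝ v x, inner ℝ e x)
        ∂(stdGaussian E) := by
        simp only [hwe, inner_add_left, real_inner_smul_left]
    _ = ∫ p, φ p.1 * ψ (ρ * p.1 + s * p.2) ∂((gaussianReal 0 1).prod (gaussianReal 0 1)) := by
        rw [← map_inner_inner_stdGaussian hv he hve,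
          integral_map (by fun_prop) hF.aestronglyMeasurable]
    _ = _ := by
        rw [integral_prod _ hFint]
        simp_rw [integral_const_mul]

theorem abs_integral_mul_inner_inner_le (hv : ‖v‖ = 1) (hw : ‖w‖ = 1) {r : ℝ} (hr : 0 < r)
    (hr8 : r ≤ 1 / 8) (hvw : |inner ℝ v w| ≤ r) (hφ : Measurable φ) (hψ : Measurable ψ)
    (hA : ∀ x, |φ x| ≤ A) (hB : ∀ x, |ψ x| ≤ B) {n : ℕ}
    (hmom : ∀ t < n, ∫ x, ψ x * x ^ t ∂(gaussianReal 0 1) = 0) :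
    |∫ x, φ (inner ℝ v x) * ψ (inner ℝ w x) ∂(stdGaussian E)| ≤ 4 * A * B * (4 * r) ^ n := by
  rw [integral_mul_inner_inner hv hw (by linarith) hφ hψ hA hB]
  have hbound : ∀ x, ‖φ x * ∫ z, ψ (inner ℝ v w * x + Real.sqrt (1 - inner ℝ v w ^ 2) * z)
      ∂(gaussianReal 0 1)‖
      ≤ A * (2 * Real.sqrt 2 * B * (4 * r) ^ n) * Real.exp (1 / 4 * x ^ 2) := fun x => by
    rw [norm_mul, mul_assoc A]
    exact mul_le_mul (hA x) (abs_integral_mul_add_sqrt_mul_le hr hr8 hvw hψ hB hmom x)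
      (norm_nonneg _) ((abs_nonneg _).trans (hA 0))
  have hexp := integrable_exp_mul_sq_gaussianReal (b := 1 / 4) (by norm_num)
  refine (norm_integral_le_of_norm_le (hexp.const_mul _) (.of_forall hbound)).trans_eq ?_
  have hsqrt : (Real.sqrt (1 - 2 * (1 / 4)))⁻¹ = Real.sqrt 2 := by
    rw [← Real.sqrt_inv]
    norm_num
  rw [integral_const_mul, integral_exp_mul_sq_gaussianReal (by norm_num), hsqrt]
  linear_combination 2 * A * B * (4 * r) ^ n * Real.mul_self_sqrt zero_le_two

end Directions

/-! ### Polynomials with Gaussian weight -/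

section GaussianWeight

open Polynomial

theorem integrable_eval_mul_exp (p : ℝ[X]) {b : ℝ} (hb : 0 < b) :
    Integrable fun x : ℝ => p.eval x * Real.exp (-b * x ^ 2) := by
  simp_rw [eval_eq_sum_range, Finset.sum_mul, mul_assoc]
  refine integrable_finsetSum _ fun i _ => Integrable.const_mul ?_ _
  have hmonomial := integrable_rpow_mul_exp_neg_mul_sq hb (s := (i : ℝ))
    (neg_one_lt_zero.trans_le (Nat.cast_nonneg i))
  simpa only [Real.rpow_natCast] using hmonomial

/-- The integral of a polynomial against the weight `exp (-x ^ 2)`. The associated inner product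
of `p` and `q` is written `gaussInt (p * q)`. -/
noncomputable def gaussInt : ℝ[X] →ₗ[ℝ] ℝ where
  toFun p := ∫ x : ℝ, p.eval x * Real.exp (-1 * x ^ 2)
  map_add' p q := by
    simp only [eval_add, add_mul]
    exact integral_add (integrable_eval_mul_exp p one_pos) (integrable_eval_mul_exp q one_pos)
  map_smul' c p := by
    simp only [eval_smul, smul_eq_mul, mul_assoc, integral_const_mul, RingHom.id_apply]

theorem gaussInt_apply (p : ℝ[X]) : gaussInt p = ∫ x : ℝ, p.eval x * Real.exp (-1 * x ^ 2) := rfl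

theorem gaussInt_C_mul (c : ℝ) (p : ℝ[X]) : gaussInt (C c * p) = c * gaussInt p := by
  rw [← smul_eq_C_mul, map_smul, smul_eq_mul]

/-- The product of the polynomial `p` with `exp (-x ^ 2 / 2)`, so that the `L²` inner product of
two such functions is `gaussInt (p * q)`. -/
noncomputable def hermiteFn (p : ℝ[X]) (x : ℝ) : ℝ := p.eval x * Real.exp (-(1 / 2) * x ^ 2)

theorem continuous_hermiteFn (p : ℝ[X]) : Continuous (hermiteFn p) := by
  unfold hermiteFn
  fun_prop

theorem hermiteFn_mul (p q : ℝ[X]) (x : ℝ) :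
    hermiteFn p x * hermiteFn q x = (p * q).eval x * Real.exp (-1 * x ^ 2) := by
  rw [hermiteFn, hermiteFn, mul_mul_mul_comm, ← Real.exp_add, eval_mul]
  ring_nf

theorem integral_hermiteFn_mul (p q : ℝ[X]) :
    ∫ x, hermiteFn p x * hermiteFn q x = gaussInt (p * q) := by
  simp only [hermiteFn_mul, gaussInt_apply]

theorem integral_hermiteFn_sq (p : ℝ[X]) : ∫ x, hermiteFn p x ^ 2 = gaussInt (p * p) := by
  simp only [sq, integral_hermiteFn_mul]

theorem integrable_hermiteFn_sq (p : ℝ[X]) : Integrable fun x => hermiteFn p x ^ 2 := by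
  simp_rw [sq (hermiteFn p _), hermiteFn_mul]
  exact integrable_eval_mul_exp _ one_pos

theorem memLp_hermiteFn (p : ℝ[X]) : MemLp (hermiteFn p) 2 :=
  (memLp_two_iff_integrable_sq (continuous_hermiteFn p).aestronglyMeasurable).2
    (integrable_hermiteFn_sq p)

theorem gaussInt_mul_self_nonneg (p : ℝ[X]) : 0 ≤ gaussInt (p * p) := by
  rw [← integral_hermiteFn_sq]
  exact integral_nonneg fun x => sq_nonneg _

theorem gaussInt_mul_sq_le (p q : ℝ[X]) :
    gaussInt (p * q) ^ 2 ≤ gaussInt (p * p) * gaussInt (q * q) := by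
  simpa only [integral_hermiteFn_mul, integral_hermiteFn_sq] using
    sq_integral_mul_le (memLp_hermiteFn p) (memLp_hermiteFn q)

theorem gaussInt_derivative (p : ℝ[X]) : gaussInt (derivative p) = 2 * gaussInt (X * p) := by
  have hderiv : ∀ x : ℝ, HasDerivAt (fun x => p.eval x * Real.exp (-1 * x ^ 2))
      ((derivative p - C 2 * (X * p)).eval x * Real.exp (-1 * x ^ 2)) x := by
    intro x
    have hexponent : HasDerivAt (fun x : ℝ => -1 * x ^ 2) (-1 * (2 * x)) x := by
      simpa using (hasDerivAt_pow 2 x).const_mul (-1 : ℝ)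
    refine ((p.hasDerivAt x).mul hexponent.exp).congr_deriv ?_
    simp only [eval_sub, eval_mul, eval_C, eval_X]
    ring
  have hzero : gaussInt (derivative p - C 2 * (X * p)) = 0 :=
    integral_eq_zero_of_hasDerivAt_of_integrable hderiv
      (integrable_eval_mul_exp _ one_pos) (integrable_eval_mul_exp p one_pos)
  rwa [map_sub, gaussInt_C_mul, sub_eq_zero] at hzero

/-- The adjoint of the derivative for the weight `exp (-x ^ 2)`. -/
noncomputable def derivAdj (p : ℝ[X]) : ℝ[X] := C 2 * (X * p) - derivative p

theorem gaussInt_derivative_mul (p q : ℝ[X]) :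
    gaussInt (derivative p * q) = gaussInt (p * derivAdj q) := by
  have hparts := gaussInt_derivative (p * q)
  rw [derivative_mul, map_add] at hparts
  have hadj : p * derivAdj q = C 2 * (X * (p * q)) - p * derivative q := by
    rw [derivAdj]
    ring
  rw [hadj, map_sub, gaussInt_C_mul]
  linarith

theorem gaussInt_derivAdj_sq (q : ℝ[X]) : gaussInt (derivAdj q * derivAdj q)
    = gaussInt (derivative q * derivative q) + 2 * gaussInt (q * q) := by
  have hcommutator :
      derivative (derivAdj q) * q = C 2 * (q * q) + q * derivAdj (derivative q) := by
    simp only [derivAdj, derivative_sub, derivative_mul, derivative_C, derivative_X]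
    ring
  rw [← gaussInt_derivative_mul, hcommutator, map_add, gaussInt_C_mul, ← gaussInt_derivative_mul]
  ring

-- `‖p'‖⁴ = ⟨p, δ p'⟩² ≤ ‖p‖² ‖δ p'‖² = ‖p‖² (‖p''‖² + 2 ‖p'‖²)` for the adjoint `δ` of the
-- derivative, and the induction hypothesis bounds `‖p''‖²` by `‖p'‖²`.
theorem gaussInt_derivative_sq_le {k : ℕ} {p : ℝ[X]} (hp : p.natDegree ≤ k) :
    gaussInt (derivative p * derivative p) ≤ 2 * k * gaussInt (p * p) := by
  induction k generalizing p with
  | zero =>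
    obtain ⟨c, rfl⟩ := natDegree_eq_zero.1 (Nat.le_zero.1 hp)
    simp
  | succ k ih =>
    have hderiv := ih (p := derivative p) ((natDegree_derivative_le p).trans (by lia))
    have hp0 := gaussInt_mul_self_nonneg p
    have hcs := gaussInt_mul_sq_le p (derivAdj (derivative p))
    rw [← gaussInt_derivative_mul, gaussInt_derivAdj_sq] at hcs
    push_cast
    rcases (gaussInt_mul_self_nonneg (derivative p)).eq_or_lt with hzero | hpos
    · rw [← hzero]
      positivity
    · refine le_of_mul_le_mul_left ?_ hpos
      nlinarith

theorem gaussInt_add_sq_le (p q : ℝ[X]) : gaussInt ((p + q) * (p + q))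
    ≤ 2 * gaussInt (p * p) + 2 * gaussInt (q * q) := by
  have hparallelogram := congrArg gaussInt
    (show (p - q) * (p - q) + (p + q) * (p + q) = C 2 * (p * p) + C 2 * (q * q) by
      simp only [map_ofNat]
      ring)
  rw [map_add, map_add, gaussInt_C_mul, gaussInt_C_mul] at hparallelogram
  linarith [gaussInt_mul_self_nonneg (p - q)]

section Degree

variable {k : ℕ} {p : ℝ[X]} (hp : p.natDegree ≤ k)

include hp

theorem gaussInt_derivAdj_sq_le :
    gaussInt (derivAdj p * derivAdj p) ≤ (2 * k + 2) * gaussInt (p * p) := by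
  rw [gaussInt_derivAdj_sq]
  linarith [gaussInt_derivative_sq_le hp]

theorem gaussInt_X_mul_sq_le :
    gaussInt ((X * p) * (X * p)) ≤ (2 * k + 1) * gaussInt (p * p) := by
  have hsum := gaussInt_add_sq_le (derivative p) (derivAdj p)
  have hX : (derivative p + derivAdj p) * (derivative p + derivAdj p)
      = C 4 * ((X * p) * (X * p)) := by
    simp only [derivAdj, map_ofNat]
    ring
  rw [hX, gaussInt_C_mul] at hsum
  linarith [gaussInt_derivative_sq_le hp, gaussInt_derivAdj_sq_le hp]

theorem gaussInt_derivative_sub_X_mul_sq_le :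
    gaussInt ((derivative p - X * p) * (derivative p - X * p))
      ≤ (2 * k + 1) * gaussInt (p * p) := by
  have hdiff := gaussInt_add_sq_le (derivative p) (-derivAdj p)
  have hX : (derivative p + -derivAdj p) * (derivative p + -derivAdj p)
      = C 4 * ((derivative p - X * p) * (derivative p - X * p)) := by
    simp only [derivAdj, map_ofNat]
    ring
  rw [hX, gaussInt_C_mul, neg_mul_neg] at hdiff
  linarith [gaussInt_derivative_sq_le hp, gaussInt_derivAdj_sq_le hp]

theorem natDegree_X_pow_mul_le (m : ℕ) : (X ^ m * p).natDegree ≤ k + m := by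
  refine natDegree_mul_le.trans ?_
  rw [natDegree_X_pow]
  lia

theorem gaussInt_X_pow_mul_sq_le_of_le {m j : ℕ} (hj : j ≤ m) :
    gaussInt ((X ^ j * p) * (X ^ j * p)) ≤ (2 * (k + m)) ^ j * gaussInt (p * p) := by
  induction j with
  | zero => simp
  | succ j ih =>
    have hstep := gaussInt_X_mul_sq_le (natDegree_X_pow_mul_le hp j)
    have hjm : (j : ℝ) + 1 ≤ m := by exact_mod_cast hj
    rw [pow_succ', mul_assoc X]
    calc _ ≤ (2 * ((k + j : ℕ) : ℝ) + 1) * gaussInt ((X ^ j * p) * (X ^ j * p)) := hstep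
      _ ≤ (2 * (k + m)) * ((2 * (k + m)) ^ j * gaussInt (p * p)) := by
          refine mul_le_mul ?_ (ih (by lia)) (gaussInt_mul_self_nonneg _) (by positivity)
          push_cast
          linarith
      _ = _ := by ring

theorem gaussInt_X_pow_mul_sq_le (m : ℕ) :
    gaussInt ((X ^ m * p) * (X ^ m * p)) ≤ (2 * (k + m)) ^ m * gaussInt (p * p) :=
  gaussInt_X_pow_mul_sq_le_of_le hp le_rfl

end Degree

theorem setIntegral_hermiteFn_sq_le (p : ℝ[X]) (S : Set ℝ) :
    ∫ x in S, hermiteFn p x ^ 2 ≤ gaussInt (p * p) := by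
  rw [← integral_hermiteFn_sq]
  exact setIntegral_le_integral (integrable_hermiteFn_sq p) (.of_forall fun x => sq_nonneg _)

theorem intervalIntegral_hermiteFn_sq_le (p : ℝ[X]) {a b : ℝ} (hab : a ≤ b) :
    ∫ x in a..b, hermiteFn p x ^ 2 ≤ gaussInt (p * p) := by
  rw [intervalIntegral.integral_of_le hab]
  exact setIntegral_hermiteFn_sq_le p _

theorem hasDerivAt_hermiteFn (p : ℝ[X]) (x : ℝ) :
    HasDerivAt (hermiteFn p) (hermiteFn (derivative p - X * p) x) x := by
  have hexponent : HasDerivAt (fun x : ℝ => -(1 / 2) * x ^ 2) (-(1 / 2) * (2 * x)) x := by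
    simpa using (hasDerivAt_pow 2 x).const_mul (-(1 / 2) : ℝ)
  refine ((p.hasDerivAt x).mul hexponent.exp).congr_deriv ?_
  simp only [hermiteFn, eval_sub, eval_mul, eval_X]
  ring

end GaussianWeight

/-! ### Sampling inequalities -/

section Interval

variable {f f' : ℝ → ℝ} {a b : ℝ}

theorem sq_intervalIntegral_le (hf : Continuous f) (hab : a ≤ b) :
    (∫ z in a..b, f z) ^ 2 ≤ (b - a) * ∫ z in a..b, f z ^ 2 := by
  have hmem : ∀ g : ℝ → ℝ, Continuous g → MemLp g 2 (volume.restrict (Set.Ioc a b)) := fun g hg =>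
    (memLp_two_iff_integrable_sq hg.aestronglyMeasurable).2 (hg.pow 2).integrableOn_Ioc
  have hcs := sq_integral_mul_le (hmem _ continuous_const) (hmem f hf) (f := fun _ => 1)
  rw [intervalIntegral.integral_of_le hab, intervalIntegral.integral_of_le hab]
  simpa [hab] using hcs

theorem sq_sub_le_of_hasDerivAt (hf : ∀ x, HasDerivAt f (f' x) x) (hf' : Continuous f')
    (hab : a ≤ b) {x y : ℝ} (hx : x ∈ Set.Icc a b) (hy : y ∈ Set.Icc a b) :
    (f x - f y) ^ 2 ≤ (b - a) * ∫ z in a..b, f' z ^ 2 := by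
  have hftc : ∫ z in y..x, f' z = f x - f y :=
    intervalIntegral.integral_eq_sub_of_hasDerivAt (fun z _ => hf z)
      (hf'.intervalIntegrable _ _)
  have habs : |∫ z in y..x, f' z| ≤ ∫ z in a..b, |f' z| := by
    calc |∫ z in y..x, f' z| ≤ |(∫ z in y..x, |f' z|)| := by
          simpa only [Real.norm_eq_abs] using
            intervalIntegral.norm_integral_le_abs_integral_norm (f := f') (μ := volume)
      _ ≤ |(∫ z in a..b, |f' z|)| := by
          refine intervalIntegral.abs_integral_mono_interval ?_ (.of_forall fun z => abs_nonneg _)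
            (hf'.abs.intervalIntegrable _ _)
          rw [Set.uIoc_of_le hab, Set.uIoc]
          exact Set.Ioc_subset_Ioc (le_min hy.1 hx.1) (max_le hy.2 hx.2)
      _ = ∫ z in a..b, |f' z| :=
          abs_of_nonneg (intervalIntegral.integral_nonneg hab fun z _ => abs_nonneg _)
  have hcs := sq_intervalIntegral_le hf'.abs hab
  simp only [sq_abs] at hcs
  rw [← hftc, ← sq_abs]
  exact (pow_le_pow_left₀ (abs_nonneg _) habs 2).trans hcs

theorem intervalIntegral_sub_average_sq (hf : Continuous f) (hab : a < b) :
    ∫ x in a..b, (f x - (∫ z in a..b, f z) / (b - a)) ^ 2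
      = (∫ x in a..b, f x ^ 2) - (∫ z in a..b, f z) ^ 2 / (b - a) := by
  set c := (∫ z in a..b, f z) / (b - a) with hc
  have hexpand : ∀ x, (f x - c) ^ 2 = (f x ^ 2 - 2 * c * f x) + c ^ 2 := fun x => by ring
  simp only [hexpand]
  rw [intervalIntegral.integral_add (Continuous.intervalIntegrable (by fun_prop) _ _)
    (continuous_const.intervalIntegrable _ _),
    intervalIntegral.integral_sub (Continuous.intervalIntegrable (by fun_prop) _ _)
    (Continuous.intervalIntegrable (by fun_prop) _ _), intervalIntegral.integral_const_mul,
    intervalIntegral.integral_const, hc, smul_eq_mul]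
  have : b - a ≠ 0 := (sub_pos.2 hab).ne'
  field_simp
  ring

theorem sq_sub_average_le (hf : ∀ x, HasDerivAt f (f' x) x) (hf' : Continuous f') (hab : a < b)
    {x : ℝ} (hx : x ∈ Set.Icc a b) :
    (f x - (∫ z in a..b, f z) / (b - a)) ^ 2 ≤ (b - a) * ∫ z in a..b, f' z ^ 2 := by
  have hcont : Continuous f := continuous_iff_continuousAt.2 fun x => (hf x).continuousAt
  have hpos : 0 < b - a := sub_pos.2 hab
  have haverage : ∫ y in a..b, (f x - f y) = (b - a) * (f x - (∫ z in a..b, f z) / (b - a)) := by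
    rw [intervalIntegral.integral_sub (continuous_const.intervalIntegrable _ _)
      (hcont.intervalIntegrable _ _), intervalIntegral.integral_const, smul_eq_mul]
    field_simp
  have hcs := sq_intervalIntegral_le (f := fun y => f x - f y) (by fun_prop) hab.le
  have hpointwise : ∫ y in a..b, (f x - f y) ^ 2
      ≤ ∫ _ in a..b, (b - a) * ∫ z in a..b, f' z ^ 2 :=
    intervalIntegral.integral_mono_on hab.le (Continuous.intervalIntegrable (by fun_prop) _ _)
      (continuous_const.intervalIntegrable _ _)
      fun y hy => sq_sub_le_of_hasDerivAt hf hf' hab.le hx hy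
  rw [intervalIntegral.integral_const, smul_eq_mul] at hpointwise
  rw [haverage, mul_pow] at hcs
  refine le_of_mul_le_mul_left ?_ (pow_pos hpos 2)
  calc _ ≤ _ := hcs
    _ ≤ (b - a) * ((b - a) * ((b - a) * ∫ z in a..b, f' z ^ 2)) := by gcongr
    _ = _ := by ring

theorem poincare_intervalIntegral (hf : ∀ x, HasDerivAt f (f' x) x) (hf' : Continuous f')
    (hab : a < b) :
    ∫ z in a..b, f z ^ 2 ≤ (∫ z in a..b, f z) ^ 2 / (b - a)
      + (b - a) ^ 2 * ∫ z in a..b, f' z ^ 2 := by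
  have hcont : Continuous f := continuous_iff_continuousAt.2 fun x => (hf x).continuousAt
  have hmono := intervalIntegral.integral_mono_on (μ := volume) hab.le
    (Continuous.intervalIntegrable (by fun_prop) _ _)
    (continuous_const.intervalIntegrable _ _) fun x hx => sq_sub_average_le hf hf' hab hx
  rw [intervalIntegral_sub_average_sq hcont hab, intervalIntegral.integral_const,
    smul_eq_mul] at hmono
  linarith

end Interval

theorem inv_one_add_sq_sq_le (x : ℝ) : ((1 + x ^ 2)⁻¹) ^ 2 ≤ (1 + x ^ 2)⁻¹ :=
  pow_le_of_le_one (by positivity) (inv_le_one_of_one_le₀ (by nlinarith [sq_nonneg x]))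
    two_ne_zero

theorem integrable_inv_one_add_sq_sq : Integrable fun x : ℝ => ((1 + x ^ 2)⁻¹) ^ 2 :=
  integrable_inv_one_add_sq.mono' (by fun_prop) (.of_forall fun x => by
    rw [Real.norm_of_nonneg (by positivity)]
    exact inv_one_add_sq_sq_le x)

theorem setIntegral_inv_one_add_sq_sq_le (S : Set ℝ) : ∫ x in S, ((1 + x ^ 2)⁻¹) ^ 2 ≤ 4 := by
  calc ∫ x in S, ((1 + x ^ 2)⁻¹) ^ 2
      ≤ ∫ x : ℝ, ((1 + x ^ 2)⁻¹) ^ 2 :=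
        setIntegral_le_integral integrable_inv_one_add_sq_sq (.of_forall fun x => sq_nonneg _)
    _ ≤ ∫ x : ℝ, (1 + x ^ 2)⁻¹ :=
        integral_mono integrable_inv_one_add_sq_sq integrable_inv_one_add_sq inv_one_add_sq_sq_le
    _ = Real.pi := integral_univ_inv_one_add_sq
    _ ≤ 4 := Real.pi_le_four

theorem sum_intervalIntegral_grid {f : ℝ → ℝ} (hf : Continuous f) (a h : ℝ) (M : ℕ) :
    ∑ j ∈ Finset.range M, ∫ z in (a + j * h)..(a + j * h + h), f z
      = ∫ z in a..(a + M * h), f z := by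
  have hadjacent := intervalIntegral.sum_integral_adjacent_intervals (μ := volume) (f := f)
    (n := M) (a := fun j : ℕ => a + j * h) (fun j _ => hf.intervalIntegrable _ _)
  simpa [add_mul, add_assoc] using hadjacent

section HermiteSampling

open Polynomial

variable {k : ℕ} {p : ℝ[X]} (hp : p.natDegree ≤ k)

include hp

-- Average over `y ∈ [x, x + l]` the bound of `p(x)` by `p(y)` and the derivative.
theorem hermiteFn_sq_le (x : ℝ) {l : ℝ} (hl : 0 < l) :
    hermiteFn p x ^ 2 ≤ (2 * l * (2 * k + 1) + 2 / l) * gaussInt (p * p) := by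
  have hxl : x ≤ x + l := by linarith
  have hderiv := (intervalIntegral_hermiteFn_sq_le (derivative p - X * p) hxl).trans
    (gaussInt_derivative_sub_X_mul_sq_le hp)
  have hcont := continuous_hermiteFn p
  have hpointwise : ∀ y ∈ Set.Icc x (x + l), hermiteFn p x ^ 2
      ≤ 2 * (l * ((2 * k + 1) * gaussInt (p * p))) + 2 * hermiteFn p y ^ 2 := by
    intro y hy
    have hdiff := sq_sub_le_of_hasDerivAt (hasDerivAt_hermiteFn p) (continuous_hermiteFn _) hxl
      (Set.left_mem_Icc.2 hxl) hy
    rw [add_sub_cancel_left] at hdiff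
    nlinarith [sq_nonneg (hermiteFn p x - 2 * hermiteFn p y),
      mul_le_mul_of_nonneg_left hderiv hl.le]
  have haverage := intervalIntegral.integral_mono_on (μ := volume) hxl
    (continuous_const.intervalIntegrable _ _)
    (Continuous.intervalIntegrable (by fun_prop) _ _) hpointwise
  rw [intervalIntegral.integral_const, intervalIntegral.integral_add
    (continuous_const.intervalIntegrable _ _) (Continuous.intervalIntegrable (by fun_prop) _ _),
    intervalIntegral.integral_const, intervalIntegral.integral_const_mul, add_sub_cancel_left,
    smul_eq_mul, smul_eq_mul] at haverage
  refine le_of_mul_le_mul_left ?_ hl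
  calc l * hermiteFn p x ^ 2
      ≤ l * (2 * (l * ((2 * k + 1) * gaussInt (p * p)))) + 2 * gaussInt (p * p) := by
        linarith [intervalIntegral_hermiteFn_sq_le p hxl]
    _ = l * ((2 * l * (2 * k + 1) + 2 / l) * gaussInt (p * p)) := by field_simp

theorem hermiteFn_sq_le_of_fine {h : ℝ} (hh : 0 < h) (hkh : (2 * k + 1) * h ^ 2 ≤ 1 / 4096)
    (x : ℝ) : hermiteFn p x ^ 2 ≤ 1 / (16 * h) * gaussInt (p * p) := by
  refine (hermiteFn_sq_le hp x (l := 64 * h) (by positivity)).trans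
    (mul_le_mul_of_nonneg_right ?_ (gaussInt_mul_self_nonneg p))
  calc 2 * (64 * h) * (2 * (k : ℝ) + 1) + 2 / (64 * h)
      = 128 * ((2 * k + 1) * h ^ 2) / h + 2 / (64 * h) := by
        field_simp
        ring
    _ ≤ 128 * (1 / 4096) / h + 2 / (64 * h) := by gcongr
    _ = 1 / (16 * h) := by
        field_simp
        norm_num

theorem sq_intervalIntegral_hermiteFn_le (a : ℝ) {h : ℝ} (hh : 0 < h)
    (hkh : (2 * k + 1) * h ^ 2 ≤ 1 / 4096) :
    (∫ z in a..(a + h), hermiteFn p z) ^ 2 ≤ h / 16 * gaussInt (p * p) := by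
  have hab : a ≤ a + h := by linarith
  have hcont := continuous_hermiteFn p
  have hcs := sq_intervalIntegral_le hcont hab
  have hmono := intervalIntegral.integral_mono_on (μ := volume) hab
    (Continuous.intervalIntegrable (by fun_prop) _ _)
    (continuous_const.intervalIntegrable _ _) (fun x _ => hermiteFn_sq_le_of_fine hp hh hkh x)
  rw [intervalIntegral.integral_const, smul_eq_mul] at hmono
  rw [add_sub_cancel_left] at hcs hmono
  calc _ ≤ h * ∫ z in a..(a + h), hermiteFn p z ^ 2 := hcs
    _ ≤ h * (h * (1 / (16 * h) * gaussInt (p * p))) := by gcongr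
    _ = _ := by field_simp

theorem gaussInt_one_add_X_sq_mul_sq_le :
    gaussInt ((1 + X ^ 2) * p * ((1 + X ^ 2) * p))
      ≤ (2 + 8 * (k + 2) ^ 2) * gaussInt (p * p) := by
  have hsum := gaussInt_add_sq_le p (X ^ 2 * p)
  have hsq := gaussInt_X_pow_mul_sq_le hp 2
  push_cast at hsq
  rw [add_mul, one_mul]
  linarith

section Tail

variable (m : ℕ) {S : Set ℝ} (hS : MeasurableSet S) {R : ℝ} (hR : 0 < R) (hSR : ∀ z ∈ S, R ≤ |z|)

include hS hR hSR

-- On the tail `1 ≤ (x / R) ^ (2 * m)`.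
theorem setIntegral_hermiteFn_sq_tail_le :
    ∫ x in S, hermiteFn p x ^ 2 ≤ (2 * (k + m) / R ^ 2) ^ m * gaussInt (p * p) := by
  have hpointwise : ∀ x ∈ S,
      hermiteFn p x ^ 2 ≤ (1 / R ^ 2) ^ m * hermiteFn (X ^ m * p) x ^ 2 := by
    intro x hx
    have hx2 : R ^ 2 ≤ x ^ 2 := sq_abs x ▸ pow_le_pow_left₀ hR.le (hSR x hx) 2
    have hweight : (1 / R ^ 2) ^ m * hermiteFn (X ^ m * p) x ^ 2
        = (x ^ 2 / R ^ 2) ^ m * hermiteFn p x ^ 2 := by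
      simp only [hermiteFn, eval_mul, eval_pow, eval_X]
      rw [div_pow, div_pow, ← pow_mul x, one_pow, mul_comm 2 m, pow_mul x]
      ring
    rw [hweight]
    refine le_mul_of_one_le_left (sq_nonneg _) (one_le_pow₀ ?_)
    rwa [one_le_div (by positivity)]
  calc ∫ x in S, hermiteFn p x ^ 2
      ≤ ∫ x in S, (1 / R ^ 2) ^ m * hermiteFn (X ^ m * p) x ^ 2 :=
        setIntegral_mono_on (integrable_hermiteFn_sq p).integrableOn
          ((integrable_hermiteFn_sq _).const_mul _).integrableOn hS hpointwise
    _ ≤ (1 / R ^ 2) ^ m * ((2 * (k + m)) ^ m * gaussInt (p * p)) := by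
        rw [integral_const_mul]
        gcongr
        exact (setIntegral_hermiteFn_sq_le _ S).trans (gaussInt_X_pow_mul_sq_le hp m)
    _ = _ := by
        rw [← mul_assoc, ← mul_pow]
        congr 2
        ring

theorem sq_setIntegral_hermiteFn_tail_le :
    (∫ x in S, hermiteFn p x) ^ 2
      ≤ 4 * (2 * (k + 2 + m) / R ^ 2) ^ m * (2 + 8 * (k + 2) ^ 2) * gaussInt (p * p) := by
  set r : ℝ[X] := (1 + X ^ 2) * p with hr
  have hdeg : r.natDegree ≤ k + 2 := by
    have hdeg_weight : (1 + X ^ 2 : ℝ[X]).natDegree ≤ 2 := by compute_degree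
    rw [add_comm]
    exact natDegree_mul_le_of_le hdeg_weight hp
  have hweight : MemLp (fun x : ℝ => (1 + x ^ 2)⁻¹) 2 :=
    (memLp_two_iff_integrable_sq (by fun_prop)).2 integrable_inv_one_add_sq_sq
  have hcs := sq_integral_mul_le ((memLp_hermiteFn r).restrict S) (hweight.restrict S)
  have hcancel : ∀ x, hermiteFn r x * (1 + x ^ 2)⁻¹ = hermiteFn p x := by
    intro x
    have : 1 + x ^ 2 ≠ 0 := by positivity
    simp only [hermiteFn, hr, eval_add, eval_mul, eval_pow, eval_X, eval_one]
    field_simp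
  simp only [hcancel] at hcs
  have htail := setIntegral_hermiteFn_sq_tail_le hdeg m hS hR hSR
  push_cast at htail
  have hp0 := gaussInt_mul_self_nonneg p
  calc _ ≤ _ := hcs
    _ ≤ (2 * (k + 2 + m) / R ^ 2) ^ m * ((2 + 8 * (k + 2) ^ 2) * gaussInt (p * p)) * 4 := by
        refine mul_le_mul (htail.trans ?_) (setIntegral_inv_one_add_sq_sq_le S)
          (integral_nonneg fun x => sq_nonneg _) (by positivity)
        gcongr
        exact gaussInt_one_add_X_sq_mul_sq_le hp
    _ = _ := by ring

end Tail

theorem sq_mul_intervalIntegral_hermiteFn_derivative_le {a b : ℝ} (hab : a ≤ b) {h : ℝ}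
    (hkh : (2 * k + 1) * h ^ 2 ≤ 1 / 4096) :
    h ^ 2 * ∫ z in a..b, hermiteFn (derivative p - X * p) z ^ 2
      ≤ 1 / 4096 * gaussInt (p * p) := by
  have hp0 := gaussInt_mul_self_nonneg p
  calc _ ≤ h ^ 2 * ((2 * k + 1) * gaussInt (p * p)) := by
        gcongr
        exact (intervalIntegral_hermiteFn_sq_le _ hab).trans
          (gaussInt_derivative_sub_X_mul_sq_le hp)
    _ = ((2 * k + 1) * h ^ 2) * gaussInt (p * p) := by ring
    _ ≤ _ := by gcongr

theorem gaussInt_le_sum_sq_intervalIntegral {h R : ℝ} (hh : 0 < h)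
    (hkh : (2 * k + 1) * h ^ 2 ≤ 1 / 4096) {M : ℕ} (hM : M * h = 2 * R) (hR : 0 < R) {m : ℕ}
    (hm : (2 * (k + m) / R ^ 2) ^ m ≤ 1 / 4) :
    gaussInt (p * p) ≤ 2 / h * ∑ j ∈ Finset.range M,
      (∫ z in (-R + j * h)..(-R + j * h + h), hermiteFn p z) ^ 2 := by
  have hRR : -R ≤ R := by linarith
  have hp0 := gaussInt_mul_self_nonneg p
  have hgrid : ∀ q : ℝ[X], ∑ j ∈ Finset.range M,
      ∫ z in (-R + j * h)..(-R + j * h + h), hermiteFn q z ^ 2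
        = ∫ z in (-R)..R, hermiteFn q z ^ 2 := by
    intro q
    rw [sum_intervalIntegral_grid (f := fun z => hermiteFn q z ^ 2)
      ((continuous_hermiteFn q).pow 2), hM]
    ring_nf
  have hcells : ∫ z in (-R)..R, hermiteFn p z ^ 2
      ≤ (∑ j ∈ Finset.range M, (∫ z in (-R + j * h)..(-R + j * h + h), hermiteFn p z) ^ 2) / h
        + h ^ 2 * ∫ z in (-R)..R, hermiteFn (derivative p - X * p) z ^ 2 := by
    rw [← hgrid, ← hgrid, Finset.sum_div, Finset.mul_sum, ← Finset.sum_add_distrib]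
    refine Finset.sum_le_sum fun j _ => ?_
    simpa only [add_sub_cancel_left] using poincare_intervalIntegral (hasDerivAt_hermiteFn p)
      (continuous_hermiteFn _) (lt_add_of_pos_right (-R + j * h) hh)
  have hderiv := sq_mul_intervalIntegral_hermiteFn_derivative_le hp hRR hkh
  have htail : ∫ z in (Set.Ioc (-R) R)ᶜ, hermiteFn p z ^ 2 ≤ 1 / 4 * gaussInt (p * p) := by
    refine (setIntegral_hermiteFn_sq_tail_le hp m measurableSet_Ioc.compl hR fun z hz => ?_).trans
      (mul_le_mul_of_nonneg_right hm hp0)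
    rw [Set.mem_compl_iff, Set.mem_Ioc, not_and_or, not_lt, not_le] at hz
    exact le_abs'.2 (hz.imp_right le_of_lt)
  have hsplit := integral_add_compl (measurableSet_Ioc (a := -R) (b := R))
    (integrable_hermiteFn_sq p)
  rw [integral_hermiteFn_sq, ← intervalIntegral.integral_of_le hRR] at hsplit
  rw [div_mul_eq_mul_div, mul_div_assoc]
  linarith

end HermiteSampling

/-! ### Classifiers that cut a line into cells -/

theorem lt_card_filter_range_iff {P : ℕ → Prop} [DecidablePred P]
    (hP : ∀ ⦃i j⦄, i ≤ j → P j → P i) (N j : ℕ) :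
    j < ((Finset.range N).filter P).card ↔ j < N ∧ P j := by
  constructor
  · contrapose!
    intro hj
    suffices h : (Finset.range N).filter P ⊆ Finset.range j from
      (Finset.card_le_card h).trans_eq (Finset.card_range j)
    intro i hi
    obtain ⟨hiN, hPi⟩ := Finset.mem_filter.1 hi
    rw [Finset.mem_range] at hiN ⊢
    by_contra! hji
    exact hj (hji.trans_lt hiN) (hP hji hPi)
  · rintro ⟨hjN, hPj⟩
    suffices h : Finset.range (j + 1) ⊆ (Finset.range N).filter P from
      (Finset.card_range (j + 1)).symm.trans_le (Finset.card_le_card h)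
    intro i hi
    rw [Finset.mem_range] at hi
    exact Finset.mem_filter.2 ⟨Finset.mem_range.2 (by omega), hP (Nat.le_of_lt_succ hi) hPj⟩

/-- The number of the thresholds `b, b + h, …, b + (N - 1) h` that lie below `z`. -/
noncomputable def cellIdx (b h : ℝ) (N : ℕ) (z : ℝ) : ℕ :=
  ((Finset.range N).filter fun l : ℕ => b + l * h < z).card

theorem cellIdx_le (b h : ℝ) (N : ℕ) (z : ℝ) : cellIdx b h N z ≤ N :=
  (Finset.card_filter_le _ _).trans_eq (Finset.card_range N)

theorem lt_cellIdx_iff (b : ℝ) {h : ℝ} (hh : 0 ≤ h) (N : ℕ) (z : ℝ) (j : ℕ) :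
    j < cellIdx b h N z ↔ j < N ∧ b + j * h < z :=
  lt_card_filter_range_iff (fun i j hij hj => lt_of_le_of_lt (by gcongr) hj) N j

theorem measurable_cellIdx (b h : ℝ) (N : ℕ) : Measurable (cellIdx b h N) := by
  have hsum : cellIdx b h N = fun z => ∑ l ∈ Finset.range N, if b + l * h < z then 1 else 0 :=
    funext fun z => Finset.card_filter _ _
  rw [hsum]
  exact Finset.measurable_sum _ fun l _ =>
    Measurable.ite measurableSet_Ioi measurable_const measurable_const

/-- The cell of `z` in the partition of the line by the thresholds `b, b + h, …, b + (N - 1) h`;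
the cells are half-open on the left, as ties are resolved by the smallest index. -/
noncomputable def cell (b h : ℝ) (N : ℕ) (z : ℝ) : Fin (N + 1) :=
  ⟨cellIdx b h N z, Nat.lt_succ_of_le (cellIdx_le b h N z)⟩

theorem measurable_cell (b h : ℝ) (N : ℕ) : Measurable (cell b h N) := by
  refine measurable_to_countable' fun j => ?_
  have hpre : cell b h N ⁻¹' {j} = cellIdx b h N ⁻¹' {(j : ℕ)} := by
    ext z
    simp [cell, Fin.ext_iff]
  rw [hpre]
  exact measurable_cellIdx b h N (measurableSet_singleton _)

theorem cell_preimage_zero (b : ℝ) {h : ℝ} (hh : 0 ≤ h) (N : ℕ) :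
    cell b h (N + 1) ⁻¹' {0} = Set.Iic b := by
  ext z
  have hlt := lt_cellIdx_iff b hh (N + 1) z 0
  simp only [Nat.zero_lt_succ, true_and, Nat.cast_zero, zero_mul, add_zero] at hlt
  simp only [Set.mem_preimage, Set.mem_singleton_iff, Set.mem_Iic, cell, Fin.ext_iff,
    Fin.val_zero, ← not_lt (a := b), ← hlt]
  omega

theorem cell_preimage_last (b : ℝ) {h : ℝ} (hh : 0 ≤ h) (N : ℕ) :
    cell b h (N + 1) ⁻¹' {Fin.last (N + 1)} = Set.Ioi (b + N * h) := by
  ext z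
  have hlt := lt_cellIdx_iff b hh (N + 1) z N
  have hle := cellIdx_le b h (N + 1) z
  simp only [Nat.lt_succ_self, true_and] at hlt
  simp only [Set.mem_preimage, Set.mem_singleton_iff, Set.mem_Ioi, cell, Fin.ext_iff,
    Fin.val_last, ← hlt]
  omega

theorem cell_preimage_castSucc_succ (b : ℝ) {h : ℝ} (hh : 0 ≤ h) {N : ℕ} (j : Fin N) :
    cell b h (N + 1) ⁻¹' {j.castSucc.succ} = Set.Ioc (b + j * h) (b + j * h + h) := by
  ext z
  have hlt := lt_cellIdx_iff b hh (N + 1) z j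
  have hlt_succ := lt_cellIdx_iff b hh (N + 1) z (j + 1)
  have hend : b + ((j + 1 : ℕ) : ℝ) * h = b + j * h + h := by
    push_cast
    ring
  rw [hend] at hlt_succ
  simp only [Set.mem_preimage, Set.mem_singleton_iff, Set.mem_Ioc, cell, Fin.ext_iff,
    Fin.val_succ, Fin.val_castSucc, ← not_lt (b := z)]
  have := j.isLt
  grind

-- With score `∑ l < j, (z - (b + l * h))` for the class `j`, the increments of the score are
-- positive up to the cell of `z` and nonpositive from there on.
theorem cell_inner_mem_linearClassifiers (b : ℝ) {h : ℝ} (hh : 0 ≤ h) (N : ℕ) {d : ℕ}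
    (v : EuclideanSpace ℝ (Fin d)) :
    (fun x => cell b h N (inner ℝ v x)) ∈ linearClassifiers d (N + 1) := by
  refine ⟨fun j => (j : ℝ) • v, fun j => -∑ l ∈ Finset.range j, (b + l * h), fun x => ?_⟩
  set z : ℝ := inner ℝ v x with hz
  set c := cell b h N z
  have hscore : ∀ j : Fin (N + 1), inner ℝ ((j : ℝ) • v) x + -∑ l ∈ Finset.range j, (b + l * h)
      = ∑ l ∈ Finset.range j, (z - (b + l * h)) := by
    intro j
    rw [Finset.sum_sub_distrib, inner_smul_left, ← hz, Finset.sum_const, Finset.card_range,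
      nsmul_eq_mul, conj_trivial, sub_eq_add_neg]
  simp only [hscore]
  have hlow : ∀ j : Fin (N + 1), j < c → ∑ l ∈ Finset.range j, (z - (b + l * h))
      < ∑ l ∈ Finset.range c, (z - (b + l * h)) := by
    intro j hj
    rw [← sub_pos, ← Finset.sum_Ico_eq_sub _ (Fin.le_def.1 hj.le)]
    refine Finset.sum_pos (fun l hl => ?_) (Finset.nonempty_Ico.2 hj)
    exact sub_pos.2 ((lt_cellIdx_iff b hh N z l).1 (Finset.mem_Ico.1 hl).2).2
  have hhigh : ∀ j : Fin (N + 1), c ≤ j → ∑ l ∈ Finset.range j, (z - (b + l * h))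
      ≤ ∑ l ∈ Finset.range c, (z - (b + l * h)) := by
    intro j hj
    rw [← sub_nonpos, ← Finset.sum_Ico_eq_sub _ (Fin.le_def.1 hj)]
    refine Finset.sum_nonpos fun l hl => ?_
    obtain ⟨hcl, hlj⟩ := Finset.mem_Ico.1 hl
    have hcl' : ¬ l < cellIdx b h N z := not_lt.2 hcl
    rw [lt_cellIdx_iff b hh, not_and, not_lt] at hcl'
    exact sub_nonpos.2 (hcl' (by omega))
  exact ⟨fun j => (lt_or_ge j c).elim (fun hj => (hlow j hj).le) (hhigh j), hlow⟩

theorem integral_comp_mul_eq_sum {X ι : Type*} [MeasurableSpace X] [Fintype ι]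
    [MeasurableSpace ι] [MeasurableSingletonClass ι] {F : X → ι} (hF : Measurable F) (a : ι → ℝ)
    {μ : Measure X} {g : X → ℝ} (hg : Integrable g μ) :
    ∫ z, a (F z) * g z ∂μ = ∑ i, a i * ∫ z in F ⁻¹' {i}, g z ∂μ := by
  have hS : ∀ i, MeasurableSet (F ⁻¹' {i}) := fun i => hF (measurableSet_singleton i)
  have hsum : ∀ z, a (F z) * g z = ∑ i, a i * (F ⁻¹' {i}).indicator g z := by
    intro z
    rw [Finset.sum_eq_single (F z)]
    · simp
    · intro i _ hi
      rw [Set.indicator_of_notMem (by simpa using hi.symm), mul_zero]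
    · simp
  simp only [hsum]
  rw [integral_finsetSum _ fun i _ => (hg.indicator (hS i)).const_mul _]
  exact Finset.sum_congr rfl fun i _ => by rw [integral_const_mul, integral_indicator (hS i)]

/-! ### Moment matching -/

/-- A perturbation `E` of the uniform confusion matrix under which the labels are uncorrelated
with all polynomials of degree `< n` of a standard Gaussian `z` with true label `F z`, while the
diagonal remains dominant and the labelling by `F` remains visibly better than chance. -/
structure IsMomentMatching {K : ℕ} (n : ℕ) (F : ℝ → Fin K) (E : Fin K → Fin K → ℝ) : Prop where
  measurable : Measurable F
  entry_le : ∀ i j, |E i j| ≤ 3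
  row_sum : ∀ i, ∑ j, E i j = 0
  diag : ∀ i j, j ≠ i → E i j + 1 / 2 ≤ E i i
  moment : ∀ t < n, ∀ j, ∫ z, E (F z) j * z ^ t ∂(gaussianReal 0 1) = 0
  gap : 1 / 8 ≤ ∫ z, E (F z) (F z) ∂(gaussianReal 0 1)

section FewClasses

theorem gaussianReal_real_Iio_zero_eq_Ioi (v : NNReal) :
    (gaussianReal 0 v).real (Set.Iio 0) = (gaussianReal 0 v).real (Set.Ioi 0) := by
  have hneg : (gaussianReal 0 v).map (fun x => -x) = gaussianReal 0 v := by
    rw [gaussianReal_map_neg, neg_zero]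
  conv_rhs => rw [← hneg]
  rw [map_measureReal_apply measurable_neg measurableSet_Ioi]
  simp

theorem gaussianReal_real_Iic_zero {v : NNReal} (hv : v ≠ 0) :
    (gaussianReal 0 v).real (Set.Iic 0) = 1 / 2 := by
  have := nullSingletonClass_gaussianReal (μ := 0) hv
  have hIic : (gaussianReal 0 v).real (Set.Iic 0) = (gaussianReal 0 v).real (Set.Iio 0) :=
    measureReal_congr Iio_ae_eq_Iic.symm
  have hcompl := probReal_compl_eq_one_sub (μ := gaussianReal 0 v)
    (measurableSet_Iic (a := (0 : ℝ)))
  rw [Set.compl_Iic] at hcompl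
  linarith [gaussianReal_real_Iio_zero_eq_Ioi v]

theorem gaussianReal_real_Ioi_zero {v : NNReal} (hv : v ≠ 0) :
    (gaussianReal 0 v).real (Set.Ioi 0) = 1 / 2 := by
  rw [← Set.compl_Iic, probReal_compl_eq_one_sub measurableSet_Iic, gaussianReal_real_Iic_zero hv]
  norm_num

-- Subtracting from the identity matrix the masses of the classes makes each label centred.
theorem exists_isMomentMatching_of_measureReal_le_half {K : ℕ} {F : ℝ → Fin K} (hF : Measurable F)
    (hhalf : ∀ i, (gaussianReal 0 1).real (F ⁻¹' {i}) ≤ 1 / 2) :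
    ∃ E, IsMomentMatching 1 F E := by
  set m : Fin K → ℝ := fun i => (gaussianReal 0 1).real (F ⁻¹' {i}) with hm
  have hm0 : ∀ i, 0 ≤ m i := fun i => measureReal_nonneg
  have hcomp : ∀ a : Fin K → ℝ, ∫ z, a (F z) ∂(gaussianReal 0 1) = ∑ i, a i * m i := by
    intro a
    simpa [hm] using
      integral_comp_mul_eq_sum hF a (μ := gaussianReal 0 1) (integrable_const (1 : ℝ))
  have hmsum : ∑ i, m i = 1 := by simpa using (hcomp fun _ => 1).symm
  refine ⟨fun i j => (if i = j then 1 else 0) - m j, hF, fun i j => ?_, fun i => ?_,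
    fun i j hij => ?_, fun t ht j => ?_, ?_⟩
  · have hm0j := hm0 j
    have hhalfj := hhalf j
    rw [abs_le]
    split_ifs <;> constructor <;> linarith
  · simp [Finset.sum_sub_distrib, hmsum]
  · rw [if_neg hij.symm, if_pos rfl]
    linarith [hm0 j, hhalf i]
  · rw [Nat.lt_one_iff.1 ht]
    simp only [pow_zero, mul_one]
    rw [hcomp fun i => (if i = j then 1 else 0) - m j]
    simp [sub_mul, Finset.sum_sub_distrib, ← Finset.mul_sum, hmsum]
  · simp only [if_true]
    rw [hcomp fun i => 1 - m i]
    calc (1 / 8 : ℝ) ≤ ∑ i, (1 / 2) * m i := by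
          rw [← Finset.mul_sum, hmsum]
          norm_num
      _ ≤ _ := Finset.sum_le_sum fun i _ =>
        mul_le_mul_of_nonneg_right (by linarith [hhalf i]) (hm0 i)

theorem exists_isMomentMatching_one_cell {h : ℝ} (hh : 0 ≤ h) (N : ℕ) :
    ∃ E, IsMomentMatching 1 (cell 0 h (N + 1)) E := by
  refine exists_isMomentMatching_of_measureReal_le_half (measurable_cell _ _ _) fun i => ?_
  rcases eq_or_ne i 0 with rfl | hi
  · rw [cell_preimage_zero 0 hh, gaussianReal_real_Iic_zero one_ne_zero]
  · rw [← gaussianReal_real_Ioi_zero one_ne_zero]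
    refine measureReal_mono ?_
    rw [← Set.compl_Iic, ← cell_preimage_zero 0 hh N]
    rintro z rfl
    exact hi

end FewClasses

section Leverage

theorem inner_starProjection_eq_inner_starProjection {V : Type*} [NormedAddCommGroup V]
    [InnerProductSpace ℝ V] (A : Submodule ℝ V) [A.HasOrthogonalProjection] (x y : V) :
    inner ℝ x (A.starProjection y) = inner ℝ (A.starProjection x) (A.starProjection y) := by
  rw [Submodule.inner_starProjection_left_eq_right,
    Submodule.starProjection_eq_self_iff.2 (Submodule.starProjection_apply_mem A y)]

variable {ι : Type*} [Fintype ι] [DecidableEq ι] {A : Submodule ℝ (EuclideanSpace ℝ ι)}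
  {c : ℝ} (hA : ∀ a ∈ A, ∀ i, a i ^ 2 ≤ c * ‖a‖ ^ 2)

include hA in
theorem norm_sq_starProjection_single_le (hc : 0 ≤ c) (i : ι) :
    ‖A.starProjection (EuclideanSpace.single i 1)‖ ^ 2 ≤ c := by
  set u := A.starProjection (EuclideanSpace.single i 1) with hu
  have hcoord : u i = ‖u‖ ^ 2 := by
    rw [← real_inner_self_eq_norm_sq, hu, ← inner_starProjection_eq_inner_starProjection,
      EuclideanSpace.inner_single_left]
    simp
  have hlev := hA u (Submodule.starProjection_apply_mem A _) i
  rw [hcoord] at hlev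
  nlinarith [sq_nonneg ‖u‖]

include hA in
theorem abs_starProjection_single_apply_le (hc : 0 ≤ c) (i j : ι) :
    |A.starProjection (EuclideanSpace.single j 1) i| ≤ c := by
  have hcoord : A.starProjection (EuclideanSpace.single j 1) i
      = inner ℝ (A.starProjection (EuclideanSpace.single i 1))
        (A.starProjection (EuclideanSpace.single j 1)) := by
    rw [← inner_starProjection_eq_inner_starProjection, EuclideanSpace.inner_single_left]
    simp
  rw [hcoord]
  have hcs := abs_real_inner_le_norm (A.starProjection (EuclideanSpace.single i 1))
    (A.starProjection (EuclideanSpace.single j 1))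
  nlinarith [norm_sq_starProjection_single_le hA hc i, norm_sq_starProjection_single_le hA hc j,
    two_mul_le_add_sq ‖A.starProjection (EuclideanSpace.single i 1)‖
      ‖A.starProjection (EuclideanSpace.single j 1)‖]

variable (A)

/-- The matrix of the orthogonal projection onto the complement of `A`. -/
noncomputable def residual (i j : ι) : ℝ :=
  (if i = j then 1 else 0) - A.starProjection (EuclideanSpace.single j 1) i

/-- The mean of the `i`-th row of `residual A`. -/
noncomputable def residualMean (i : ι) : ℝ := (∑ j, residual A i j) / Fintype.card ι

theorem sum_residual_mul_eq_zero {a : EuclideanSpace ℝ ι} (ha : a ∈ A) (j : ι) :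
    ∑ i, residual A i j * a i = 0 := by
  have horth := (Submodule.sub_starProjection_mem_orthogonal (K := A) (EuclideanSpace.single j 1))
    a ha
  rw [PiLp.inner_apply] at horth
  simpa [residual, PiLp.single_apply, mul_comm] using horth

theorem sum_residualMean_mul_eq_zero {a : EuclideanSpace ℝ ι} (ha : a ∈ A) :
    ∑ i, residualMean A i * a i = 0 := by
  simp only [residualMean, div_mul_eq_mul_div, ← Finset.sum_div, Finset.sum_mul]
  rw [Finset.sum_comm, Finset.sum_eq_zero fun j _ => sum_residual_mul_eq_zero A ha j, zero_div]

theorem sum_residual_sub_residualMean [Nonempty ι] (i : ι) :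
    ∑ j, (residual A i j - residualMean A i) = 0 := by
  have hcard : (Fintype.card ι : ℝ) ≠ 0 := Nat.cast_ne_zero.2 Fintype.card_ne_zero
  rw [Finset.sum_sub_distrib, Finset.sum_const, Finset.card_univ, nsmul_eq_mul, residualMean,
    mul_div_cancel₀ _ hcard, sub_self]

variable {A}

include hA in
theorem abs_residual_le (hc : 0 ≤ c) (i j : ι) : |residual A i j| ≤ 1 + c := by
  have hproj := abs_le.1 (abs_starProjection_single_apply_le hA hc i j)
  rw [residual, abs_le]
  split_ifs <;> constructor <;> linarith

include hA in
theorem abs_residualMean_le (hc : 0 ≤ c) (i : ι) : |residualMean A i| ≤ 1 + c := by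
  have hcard : 0 < (Fintype.card ι : ℝ) := Nat.cast_pos.2 (Fintype.card_pos_iff.2 ⟨i⟩)
  rw [residualMean, abs_div, Nat.abs_cast, div_le_iff₀ hcard]
  calc |∑ j, residual A i j| ≤ ∑ j, |residual A i j| := Finset.abs_sum_le_sum_abs _ _
    _ ≤ ∑ _ : ι, (1 + c) := Finset.sum_le_sum fun j _ => abs_residual_le hA hc i j
    _ = (1 + c) * Fintype.card ι := by
      rw [Finset.sum_const, Finset.card_univ, nsmul_eq_mul, mul_comm]

include hA in
theorem one_sub_le_residual_self (hc : 0 ≤ c) (i : ι) : 1 - c ≤ residual A i i := by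
  rw [residual, if_pos rfl]
  linarith [(abs_le.1 (abs_starProjection_single_apply_le hA hc i i)).2]

include hA in
theorem residual_le_of_ne (hc : 0 ≤ c) {i j : ι} (hij : i ≠ j) : residual A i j ≤ c := by
  rw [residual, if_neg hij]
  linarith [(abs_le.1 (abs_starProjection_single_apply_le hA hc i j)).1]

end Leverage

section FibreIntegrals

open Polynomial

variable {K : ℕ} {F : ℝ → Fin K}

theorem integrable_eval_gaussianReal (p : ℝ[X]) (μ : ℝ) (v : NNReal) :
    Integrable (fun z => p.eval z) (gaussianReal μ v) := by
  simp only [eval_eq_sum_range]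
  exact integrable_finsetSum _ fun i _ => (integrable_pow_gaussianReal μ v i).const_mul _

/-- The Gaussian integrals of a polynomial over the fibres of `F`. -/
noncomputable def fibreIntegrals (F : ℝ → Fin K) : ℝ[X] →ₗ[ℝ] EuclideanSpace ℝ (Fin K) where
  toFun p := WithLp.toLp 2 fun i => ∫ z in F ⁻¹' {i}, p.eval z ∂(gaussianReal 0 1)
  map_add' p q := by
    ext i
    simp only [eval_add, PiLp.add_apply]
    exact integral_add (integrable_eval_gaussianReal p 0 1).integrableOn
      (integrable_eval_gaussianReal q 0 1).integrableOn
  map_smul' c p := by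
    ext i
    simp [integral_const_mul]

theorem fibreIntegrals_apply (F : ℝ → Fin K) (p : ℝ[X]) (i : Fin K) :
    fibreIntegrals F p i = ∫ z in F ⁻¹' {i}, p.eval z ∂(gaussianReal 0 1) := rfl

theorem integral_comp_mul_eval_gaussianReal (hF : Measurable F) (a : Fin K → ℝ) (p : ℝ[X]) :
    ∫ z, a (F z) * p.eval z ∂(gaussianReal 0 1) = ∑ i, a i * fibreIntegrals F p i :=
  integral_comp_mul_eq_sum hF a (integrable_eval_gaussianReal p 0 1)

-- The columns of the residual matrix of the space of fibre integrals satisfy the moment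
-- conditions; so does the mean of the columns, whose subtraction makes the rows sum to zero.
theorem exists_isMomentMatching_of_leverage {n : ℕ} (hn : 0 < n) (hF : Measurable F)
    (hlev : ∀ p : ℝ[X], p.natDegree < n → ∀ i,
      8 * fibreIntegrals F p i ^ 2 ≤ ‖fibreIntegrals F p‖ ^ 2) :
    ∃ E, IsMomentMatching n F E := by
  have : Nonempty (Fin K) := ⟨F 0⟩
  set A : Submodule ℝ (EuclideanSpace ℝ (Fin K)) := (degreeLT ℝ n).map (fibreIntegrals F)
  have hmem : ∀ t < n, fibreIntegrals F (X ^ t) ∈ A := fun t ht =>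
    Submodule.mem_map_of_mem (mem_degreeLT.2 (by rw [degree_X_pow]; exact_mod_cast ht))
  have hlevA : ∀ a ∈ A, ∀ i, a i ^ 2 ≤ 1 / 8 * ‖a‖ ^ 2 := by
    rintro _ ⟨p, hp, rfl⟩ i
    have hdeg : p.natDegree < n := by
      rw [SetLike.mem_coe, mem_degreeLT] at hp
      rcases eq_or_ne p 0 with rfl | hp0
      · simpa only [natDegree_zero] using hn
      · exact (natDegree_lt_iff_degree_lt hp0).2 hp
    linarith [hlev p hdeg i]
  have hc : (0 : ℝ) ≤ 1 / 8 := by norm_num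
  refine ⟨fun i j => residual A i j - residualMean A i, hF, fun i j => ?_,
    sum_residual_sub_residualMean A, fun i j hij => ?_, fun t ht j => ?_, ?_⟩
  · linarith [abs_sub (residual A i j) (residualMean A i), abs_residual_le hlevA hc i j,
      abs_residualMean_le hlevA hc i]
  · linarith [one_sub_le_residual_self hlevA hc i, residual_le_of_ne hlevA hc hij.symm]
  · have hsum := integral_comp_mul_eval_gaussianReal hF
      (fun i => residual A i j - residualMean A i) (X ^ t)
    simp only [eval_pow, eval_X, sub_mul, Finset.sum_sub_distrib,
      sum_residual_mul_eq_zero A (hmem t ht), sum_residualMean_mul_eq_zero A (hmem t ht)] at hsum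
    simpa only [sub_mul, sub_zero] using hsum
  · have hmem_one : fibreIntegrals F 1 ∈ A := by simpa only [pow_zero] using hmem 0 hn
    have hgap := integral_comp_mul_eval_gaussianReal hF
      (fun i => residual A i i - residualMean A i) 1
    have hmass := integral_comp_mul_eval_gaussianReal hF (fun _ => 7 / 8) 1
    simp only [sub_mul _ _ (fibreIntegrals F 1 _), Finset.sum_sub_distrib,
      sum_residualMean_mul_eq_zero A hmem_one, sub_zero, eval_one, mul_one] at hgap hmass
    rw [integral_const, probReal_univ, one_smul] at hmass
    rw [hgap]
    calc (1 / 8 : ℝ) ≤ 7 / 8 := by norm_num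
      _ = _ := hmass
      _ ≤ _ := Finset.sum_le_sum fun i _ => mul_le_mul_of_nonneg_right
        (by linarith [one_sub_le_residual_self hlevA hc i])
        (integral_nonneg fun z => by simp)

end FibreIntegrals

section Grid

open Polynomial

theorem fibreIntegrals_eq_mul_setIntegral_hermiteFn {K : ℕ} {F : ℝ → Fin K} (hF : Measurable F)
    (p : ℝ[X]) (i : Fin K) :
    fibreIntegrals F p i = (√(2 * Real.pi))⁻¹ * ∫ z in F ⁻¹' {i}, hermiteFn p z := by
  have hS : MeasurableSet (F ⁻¹' {i}) := hF (measurableSet_singleton i)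
  rw [fibreIntegrals_apply, ← integral_indicator hS,
    integral_gaussianReal_eq_integral_smul one_ne_zero, ← integral_const_mul,
    ← integral_indicator hS]
  refine integral_congr_ae (.of_forall fun z => ?_)
  by_cases hz : z ∈ F ⁻¹' {i}
  · have hexp : -z ^ 2 / 2 = -(1 / 2) * z ^ 2 := by ring
    simp only [Set.indicator_of_mem hz, smul_eq_mul, gaussianPDFReal, hermiteFn, NNReal.coe_one,
      mul_one, sub_zero, hexp]
    ring
  · simp only [Set.indicator_of_notMem hz, smul_zero]

/-- The division of `[-R, R]` into `M` cells of width `h` resolves the polynomials of degree at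
most `k`: no cell, and neither of the tails, carries more than a small share of the mass of such a
polynomial under the Gaussian weight. -/
structure IsFineGrid (k M : ℕ) (h R : ℝ) : Prop where
  width_pos : 0 < h
  radius_pos : 0 < R
  mul_width : M * h = 2 * R
  fine : (2 * k + 1) * h ^ 2 ≤ 1 / 4096
  tail_le : (2 * (k + (k + 1 : ℕ)) / R ^ 2) ^ (k + 1) ≤ 1 / 4
  weighted_tail_le :
    4 * (2 * (k + 2 + (k + 1 : ℕ)) / R ^ 2) ^ (k + 1) * (2 + 8 * ((k : ℝ) + 2) ^ 2) ≤ h / 16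

namespace IsFineGrid

variable {k M : ℕ} {h R : ℝ} (hgrid : IsFineGrid k M h R) {p : ℝ[X]} (hp : p.natDegree ≤ k)
include hgrid hp

theorem gaussInt_mul_self_le :
    gaussInt (p * p) ≤
      2 / h * ∑ i, (∫ z in cell (-R) h (M + 1) ⁻¹' {i}, hermiteFn p z) ^ 2 := by
  have hh := hgrid.width_pos
  refine (gaussInt_le_sum_sq_intervalIntegral hp hh hgrid.fine hgrid.mul_width hgrid.radius_pos
    hgrid.tail_le).trans (mul_le_mul_of_nonneg_left ?_ (by positivity))
  have hinner : ∀ j : Fin M, ∫ z in cell (-R) h (M + 1) ⁻¹' {j.castSucc.succ}, hermiteFn p z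
      = ∫ z in (-R + j * h)..(-R + j * h + h), hermiteFn p z := fun j => by
    rw [cell_preimage_castSucc_succ _ hh.le, intervalIntegral.integral_of_le (by linarith)]
  rw [Fin.sum_univ_succ, Fin.sum_univ_castSucc, Finset.sum_range]
  simp only [hinner]
  linarith [sq_nonneg (∫ z in cell (-R) h (M + 1) ⁻¹' {0}, hermiteFn p z),
    sq_nonneg (∫ z in cell (-R) h (M + 1) ⁻¹' {(Fin.last M).succ}, hermiteFn p z)]

theorem sq_setIntegral_cell_le (i : Fin (M + 2)) :
    (∫ z in cell (-R) h (M + 1) ⁻¹' {i}, hermiteFn p z) ^ 2 ≤ h / 16 * gaussInt (p * p) := by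
  have hh := hgrid.width_pos
  have htail : (∀ z ∈ cell (-R) h (M + 1) ⁻¹' {i}, R ≤ |z|) →
      (∫ z in cell (-R) h (M + 1) ⁻¹' {i}, hermiteFn p z) ^ 2 ≤ h / 16 * gaussInt (p * p) :=
    fun hi => (sq_setIntegral_hermiteFn_tail_le hp (k + 1)
      (measurable_cell _ _ _ (measurableSet_singleton i)) hgrid.radius_pos hi).trans
      (mul_le_mul_of_nonneg_right hgrid.weighted_tail_le (gaussInt_mul_self_nonneg p))
  induction i using Fin.cases with
  | zero =>
    refine htail fun z hz => ?_
    rw [cell_preimage_zero _ hh.le, Set.mem_Iic] at hz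
    exact le_abs.2 (.inr (by linarith))
  | succ i =>
    induction i using Fin.lastCases with
    | last =>
      refine htail fun z hz => ?_
      rw [Fin.succ_last, cell_preimage_last _ hh.le, Set.mem_Ioi, hgrid.mul_width] at hz
      exact le_abs.2 (.inl (by linarith))
    | cast j =>
      rw [cell_preimage_castSucc_succ _ hh.le, ← intervalIntegral.integral_of_le (by linarith)]
      exact sq_intervalIntegral_hermiteFn_le hp _ hh hgrid.fine

theorem eight_mul_fibreIntegrals_sq_le (i : Fin (M + 2)) :
    8 * fibreIntegrals (cell (-R) h (M + 1)) p i ^ 2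
      ≤ ‖fibreIntegrals (cell (-R) h (M + 1)) p‖ ^ 2 := by
  have hh := hgrid.width_pos
  set a : Fin (M + 2) → ℝ := fun i => ∫ z in cell (-R) h (M + 1) ⁻¹' {i}, hermiteFn p z
  have hleverage : 8 * a i ^ 2 ≤ ∑ j, a j ^ 2 :=
    calc 8 * a i ^ 2 ≤ 8 * (h / 16 * (2 / h * ∑ j, a j ^ 2)) := by
          gcongr
          exact (hgrid.sq_setIntegral_cell_le hp i).trans
            (mul_le_mul_of_nonneg_left (hgrid.gaussInt_mul_self_le hp) (by positivity))
      _ = ∑ j, a j ^ 2 := by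
          field_simp
          norm_num
  rw [EuclideanSpace.real_norm_sq_eq]
  simp_rw [fibreIntegrals_eq_mul_setIntegral_hermiteFn (measurable_cell _ _ _), mul_pow]
  rw [← Finset.mul_sum]
  linarith [mul_le_mul_of_nonneg_left hleverage (sq_nonneg (√(2 * Real.pi))⁻¹)]

end IsFineGrid

/-- A cell width that resolves polynomials of degree `< n`. -/
noncomputable def gridWidth (n : ℝ) : ℝ := (√(8192 * n))⁻¹

theorem gridWidth_pos {n : ℝ} (hn : 0 < n) : 0 < gridWidth n :=
  inv_pos.2 (Real.sqrt_pos.2 (by positivity))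

theorem gridWidth_sq {n : ℝ} (hn : 0 ≤ n) : gridWidth n ^ 2 = 1 / (8192 * n) := by
  rw [gridWidth, inv_pow, Real.sq_sqrt (by positivity), one_div]

theorem one_div_le_gridWidth {n : ℝ} (hn : 1 ≤ n) : 1 / (128 * n) ≤ gridWidth n := by
  rw [gridWidth, ← one_div]
  refine one_div_le_one_div_of_le (Real.sqrt_pos.2 (by positivity)) ?_
  rw [Real.sqrt_le_left (by positivity)]
  nlinarith

theorem le_sq_half_mul_gridWidth {n M : ℝ} (hn : 0 < n) (hM : 1024 * n ≤ M) :
    32 * n ≤ (M * gridWidth n / 2) ^ 2 := by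
  have hsq : (M * gridWidth n / 2) ^ 2 = M ^ 2 / (32768 * n) := by
    rw [div_pow, mul_pow, gridWidth_sq hn.le]
    field_simp
    ring
  rw [hsq, le_div_iff₀ (by positivity)]
  nlinarith

theorem weighted_tail_le_of_pow_le {k : ℕ} {x : ℝ} (hx : 0 ≤ x) (hx' : x ≤ 3 / 16)
    (hsmall : ((k : ℝ) + 1) ^ 3 * (3 / 16) ^ (k + 1) ≤ 1 / 1000000) :
    4 * x ^ (k + 1) * (2 + 8 * ((k : ℝ) + 2) ^ 2) ≤ gridWidth (k + 1) / 16 := by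
  have hk : (1 : ℝ) ≤ k + 1 := by linarith [(k.cast_nonneg : (0 : ℝ) ≤ k)]
  have hquad : 2 + 8 * ((k : ℝ) + 2) ^ 2 ≤ 34 * ((k : ℝ) + 1) ^ 2 := by nlinarith
  calc _ ≤ 4 * (3 / 16 : ℝ) ^ (k + 1) * (34 * ((k : ℝ) + 1) ^ 2) := by gcongr
    _ = 136 / ((k : ℝ) + 1) * (((k : ℝ) + 1) ^ 3 * (3 / 16) ^ (k + 1)) := by
      field_simp
      norm_num
    _ ≤ 136 / ((k : ℝ) + 1) * (1 / 1000000) := by gcongr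
    _ ≤ 1 / (128 * ((k : ℝ) + 1)) / 16 := by
      rw [div_mul_eq_mul_div, div_div, div_le_div_iff₀ (by positivity) (by positivity)]
      nlinarith
    _ ≤ _ := by
      gcongr
      exact one_div_le_gridWidth hk

theorem isFineGrid_gridWidth {k M : ℕ} (hM : 1024 * (k + 1) ≤ M)
    (hsmall : ((k : ℝ) + 1) ^ 3 * (3 / 16) ^ (k + 1) ≤ 1 / 1000000) :
    IsFineGrid k M (gridWidth (k + 1)) (M * gridWidth (k + 1) / 2) := by
  have hk : (0 : ℝ) < k + 1 := k.cast_add_one_pos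
  have hM' : 1024 * ((k : ℝ) + 1) ≤ M := by exact_mod_cast hM
  have hMpos : (0 : ℝ) < M := by linarith
  have hwidth := gridWidth_pos hk
  have hradius := le_sq_half_mul_gridWidth hk hM'
  refine ⟨hwidth, by positivity, by ring, ?_, ?_, ?_⟩
  · rw [gridWidth_sq hk.le, mul_one_div, div_le_iff₀ (by positivity)]
    linarith
  · push_cast
    calc _ ≤ (1 / 4 : ℝ) ^ (k + 1) := by
          refine pow_le_pow_left₀ (by positivity) ?_ _
          rw [div_le_iff₀ (by positivity)]
          linarith
      _ ≤ _ := pow_le_of_le_one (by norm_num) (by norm_num) k.succ_ne_zero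
  · push_cast
    refine weighted_tail_le_of_pow_le (by positivity) ?_ hsmall
    rw [div_le_iff₀ (by positivity)]
    linarith

theorem eventually_isFineGrid : ∀ᶠ n : ℕ in Filter.atTop, ∀ k M : ℕ, n = k + 1 →
    1024 * n ≤ M → ∃ h R, IsFineGrid k M h R := by
  have htendsto := tendsto_pow_const_mul_const_pow_of_abs_lt_one 3 (r := 3 / 16)
    (abs_lt.2 ⟨by norm_num, by norm_num⟩)
  filter_upwards [htendsto.eventually_le_const (by norm_num : (0 : ℝ) < 1 / 1000000)]
  rintro _ hsmall k M rfl hM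
  exact ⟨_, _, isFineGrid_gridWidth hM (by exact_mod_cast hsmall)⟩

end Grid

theorem exists_linearClassifier_isMomentMatching : ∃ c : ℕ, 0 < c ∧ ∀ K : ℕ, 2 ≤ K →
    ∃ n : ℕ, K ≤ c * n ∧ ∃ (F : ℝ → Fin K) (E : Fin K → Fin K → ℝ),
      (∀ (d : ℕ) (v : EuclideanSpace ℝ (Fin d)),
        (fun x => F (inner ℝ v x)) ∈ linearClassifiers d K) ∧ IsMomentMatching n F E := by
  obtain ⟨n₀, hn₀⟩ := Filter.eventually_atTop.1 eventually_isFineGrid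
  refine ⟨1024 * (n₀ + 3), by omega, fun K hK => ?_⟩
  obtain ⟨M, rfl⟩ : ∃ M, K = M + 2 := ⟨K - 2, by omega⟩
  by_cases hbig : n₀ + 1 ≤ M / 1024
  · obtain ⟨k, hk⟩ : ∃ k, M / 1024 = k + 1 := ⟨M / 1024 - 1, by omega⟩
    obtain ⟨h, R, hgrid⟩ := hn₀ (k + 1) (by omega) k M rfl (by omega)
    obtain ⟨E, hE⟩ := exists_isMomentMatching_of_leverage k.succ_pos (measurable_cell (-R) h _)
      fun p hp => hgrid.eight_mul_fibreIntegrals_sq_le (Nat.le_of_lt_succ hp)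
    have hc : M + 2 ≤ 1024 * (n₀ + 3) * (k + 1) :=
      (by omega : M + 2 ≤ 1024 * 3 * (k + 1)).trans (by gcongr; omega)
    exact ⟨k + 1, hc, _, E,
      fun d v => cell_inner_mem_linearClassifiers _ hgrid.width_pos.le _ v, hE⟩
  · obtain ⟨E, hE⟩ := exists_isMomentMatching_one_cell zero_le_one M
    exact ⟨1, by omega, _, E,
      fun d v => cell_inner_mem_linearClassifiers _ zero_le_one _ v, hE⟩

/-! ### Distributions with a hidden direction -/

section UniformLabel

variable {K : ℕ} [NeZero K]

/-- The uniform distribution on the `K` labels. -/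
noncomputable def uniformLabel (K : ℕ) [NeZero K] : Measure (Fin K) :=
  (PMF.uniformOfFintype (Fin K)).toMeasure

instance : IsProbabilityMeasure (uniformLabel K) := by
  unfold uniformLabel
  infer_instance

theorem uniformLabel_singleton (i : Fin K) : uniformLabel K {i} = (K : ENNReal)⁻¹ := by
  rw [uniformLabel, PMF.toMeasure_apply_singleton _ _ (measurableSet_singleton i),
    PMF.uniformOfFintype_apply, Fintype.card_fin]

theorem integral_uniformLabel (f : Fin K → ℝ) :
    ∫ i, f i ∂(uniformLabel K) = (∑ i, f i) / K := by
  rw [uniformLabel, PMF.integral_eq_sum]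
  simp [div_eq_inv_mul, Finset.mul_sum]

/-- Standard Gaussian points with independent uniform labels. -/
noncomputable def nullDist (d K : ℕ) [NeZero K] : Measure (Example d K) :=
  (stdGaussian (EuclideanSpace ℝ (Fin d))).prod (uniformLabel K)

instance (d : ℕ) : IsProbabilityMeasure (nullDist d K) := by
  unfold nullDist
  infer_instance

end UniformLabel

/-- The relative deviation from `nullDist` when the label depends on `x` through `F ⟪v, x⟫` only,
and the confusion matrix deviates from the uniform one by the multiple `1 / 6` of `E`. -/
noncomputable def hiddenPert {d K : ℕ} (F : ℝ → Fin K) (E : Fin K → Fin K → ℝ)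
    (v : EuclideanSpace ℝ (Fin d)) (p : Example d K) : ℝ :=
  E (F (inner ℝ v p.1)) p.2 / 6

/-- The distribution of labelled examples with hidden direction `v`. -/
noncomputable def hiddenDist {d K : ℕ} [NeZero K] (F : ℝ → Fin K) (E : Fin K → Fin K → ℝ)
    (v : EuclideanSpace ℝ (Fin d)) : Measure (Example d K) :=
  perturb (nullDist d K) (hiddenPert F E v)

/-- The confusion matrix of the hidden direction distributions. -/
noncomputable def confusion {K : ℕ} (E : Fin K → Fin K → ℝ) : Matrix (Fin K) (Fin K) ℝ :=
  fun i j => (1 + E i j / 6) / K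

namespace IsMomentMatching

variable {d K n : ℕ} {F : ℝ → Fin K} {E : Fin K → Fin K → ℝ} (hE : IsMomentMatching n F E)

include hE

theorem measurable_comp (φ : Fin K → ℝ) : Measurable fun z => φ (F z) :=
  Measurable.of_discrete.comp hE.measurable

theorem abs_div_six_le (i j : Fin K) : |E i j / 6| ≤ 1 / 2 := by
  rw [abs_div, abs_of_pos (by norm_num : (0 : ℝ) < 6)]
  linarith [hE.entry_le i j]

theorem measurable_hiddenPert (v : EuclideanSpace ℝ (Fin d)) : Measurable (hiddenPert F E v) := by
  have hentry : Measurable fun p : Fin K × Fin K => E p.1 p.2 / 6 := .of_discrete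
  have hF := hE.measurable
  exact hentry.comp (by fun_prop : Measurable fun p : Example d K => (F (inner ℝ v p.1), p.2))

theorem isPerturbation_hiddenPert [NeZero K] (v : EuclideanSpace ℝ (Fin d)) :
    IsPerturbation (nullDist d K) (hiddenPert F E v) where
  measurable := hE.measurable_hiddenPert v
  abs_le_half p := hE.abs_div_six_le _ _
  integral_eq_zero := by
    rw [nullDist, integral_prod _ (Integrable.of_bound
      (hE.measurable_hiddenPert v).aestronglyMeasurable _
      (.of_forall fun p => hE.abs_div_six_le _ _))]
    simp only [integral_uniformLabel, hiddenPert, ← Finset.sum_div, hE.row_sum, zero_div,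
      integral_zero]

theorem abs_integral_hiddenPert_mul_le [NeZero K] {v w : EuclideanSpace ℝ (Fin d)} (hv : ‖v‖ = 1)
    (hw : ‖w‖ = 1) {r : ℝ} (hr : 0 < r) (hr8 : r ≤ 1 / 8) (hvw : |inner ℝ v w| ≤ r) :
    |∫ p, hiddenPert F E v p * hiddenPert F E w p ∂(nullDist d K)| ≤ (4 * r) ^ n := by
  have hlabel : ∀ i : Fin K, |∫ x, hiddenPert F E v (x, i) * hiddenPert F E w (x, i)
      ∂(stdGaussian (EuclideanSpace ℝ (Fin d)))| ≤ (4 * r) ^ n := by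
    intro i
    have hmeas := hE.measurable_comp fun l => E l i / 6
    refine (abs_integral_mul_inner_inner_le (n := n) hv hw hr hr8 hvw hmeas hmeas
      (fun z => hE.abs_div_six_le _ i) (fun z => hE.abs_div_six_le _ i) fun t ht => ?_).trans_eq ?_
    · simp only [div_mul_eq_mul_div]
      rw [integral_div, hE.moment t ht i, zero_div]
    · ring
  have hK : (0 : ℝ) < K := Nat.cast_pos.2 (NeZero.pos K)
  have hint : Integrable (fun p => hiddenPert F E v p * hiddenPert F E w p) (nullDist d K) :=
    (hE.isPerturbation_hiddenPert v).memLp_two.integrable_mul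
      (hE.isPerturbation_hiddenPert w).memLp_two
  rw [nullDist] at hint ⊢
  rw [integral_prod_symm _ hint, integral_uniformLabel, abs_div, Nat.abs_cast, div_le_iff₀ hK]
  calc _ ≤ ∑ _ : Fin K, (4 * r) ^ n :=
        (Finset.abs_sum_le_sum_abs _ _).trans (Finset.sum_le_sum fun i _ => hlabel i)
    _ = (4 * r) ^ n * K := by
      rw [Finset.sum_const, Finset.card_univ, Fintype.card_fin, nsmul_eq_mul, mul_comm]

theorem confusion_mem_rowStochastic [NeZero K] :
    confusion E ∈ Matrix.rowStochastic ℝ (Fin K) := by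
  have hK : (K : ℝ) ≠ 0 := NeZero.ne _
  rw [Matrix.mem_rowStochastic_iff_sum]
  refine ⟨fun i j => ?_, fun i => ?_⟩
  · exact div_nonneg (by linarith [(abs_le.1 (hE.abs_div_six_le i j)).1]) K.cast_nonneg
  · simp only [confusion]
    rw [← Finset.sum_div, Finset.sum_add_distrib, ← Finset.sum_div, hE.row_sum]
    simp [hK]

theorem hiddenDist_prod_singleton [NeZero K] (v : EuclideanSpace ℝ (Fin d)) (i : Fin K)
    {A : Set (EuclideanSpace ℝ (Fin d))} (hA : MeasurableSet A) :
    hiddenDist F E v (A ×ˢ {i}) = ∫⁻ x in A, ENNReal.ofReal (confusion E (F (inner ℝ v x)) i)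
      ∂(stdGaussian (EuclideanSpace ℝ (Fin d))) := by
  have hK : (0 : ℝ) < K := Nat.cast_pos.2 (NeZero.pos K)
  have hmeas : Measurable fun p => ENNReal.ofReal (1 + hiddenPert F E v p) :=
    ((hE.measurable_hiddenPert v).const_add 1).ennreal_ofReal
  rw [hiddenDist, perturb, withDensity_apply _ (hA.prod (measurableSet_singleton i)), nullDist,
    ← Measure.prod_restrict, lintegral_prod _ hmeas.aemeasurable]
  refine lintegral_congr fun x => ?_
  rw [lintegral_singleton, uniformLabel_singleton, ← ENNReal.ofReal_natCast,
    ← ENNReal.ofReal_inv_of_pos hK, ← ENNReal.ofReal_mul]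
  · rfl
  · linarith [(hE.isPerturbation_hiddenPert v).half_le_one_add (x, i)]

theorem fst_hiddenDist [NeZero K] (v : EuclideanSpace ℝ (Fin d)) :
    (hiddenDist F E v).fst = stdGaussian (EuclideanSpace ℝ (Fin d)) := by
  ext A hA
  have hmeas : ∀ i, Measurable fun x : EuclideanSpace ℝ (Fin d) =>
      ENNReal.ofReal (confusion E (F (inner ℝ v x)) i) := fun i =>
    ((hE.measurable_comp fun l => confusion E l i).comp (by fun_prop)).ennreal_ofReal
  obtain ⟨hnonneg, hsum⟩ := Matrix.mem_rowStochastic_iff_sum.1 hE.confusion_mem_rowStochastic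
  have hfibres : Prod.fst ⁻¹' A = ⋃ i : Fin K, A ×ˢ {i} := by
    ext p
    simp
  rw [Measure.fst_apply hA, hfibres, measure_iUnion
    (fun i j hij => Set.disjoint_left.2 fun p hp hq => hij (hp.2.symm.trans hq.2))
    fun i => hA.prod (measurableSet_singleton i), tsum_fintype]
  simp_rw [hE.hiddenDist_prod_singleton v _ hA]
  rw [← lintegral_finsetSum _ fun i _ => hmeas i, ← setLIntegral_one]
  refine lintegral_congr fun x => ?_
  rw [← ENNReal.ofReal_sum_of_nonneg fun i _ => hnonneg _ _, hsum, ENNReal.ofReal_one]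

theorem confusion_add_lt [NeZero K] {γ : ℝ} (hγ : γ < 1 / (12 * K)) {i j : Fin K} (hij : j ≠ i) :
    confusion E i j + γ < confusion E i i := by
  have hK : (0 : ℝ) < K := Nat.cast_pos.2 (NeZero.pos K)
  calc confusion E i j + γ < (1 + E i j / 6) / K + 1 / (12 * K) := by
        rw [confusion]
        gcongr
    _ = (1 + (E i j + 1 / 2) / 6) / K := by
        field_simp
        ring
    _ ≤ confusion E i i := by
        rw [confusion]
        gcongr
        exact hE.diag i j hij

theorem isInput_hiddenDist [NeZero K] {v : EuclideanSpace ℝ (Fin d)}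
    (hlin : (fun x => F (inner ℝ v x)) ∈ linearClassifiers d K) {γ : ℝ} (hγ : γ < 1 / (12 * K)) :
    IsInput d K γ (hiddenDist F E v) := by
  refine ⟨(hE.isPerturbation_hiddenPert v).isProbabilityMeasure_perturb, hE.fst_hiddenDist v, _,
    hlin, confusion E, hE.confusion_mem_rowStochastic, fun i j => hE.confusion_add_lt hγ,
    fun i A hA => ?_⟩
  rw [hE.fst_hiddenDist v]
  exact hE.hiddenDist_prod_singleton v i hA

end IsMomentMatching

/-! ### Errors of hypotheses -/

section Hit

variable {X : Type*} {K : ℕ}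

/-- The indicator function of a correct prediction. -/
noncomputable def hit (h : X → Fin K) (p : X × Fin K) : ℝ :=
  if h p.1 = p.2 then 1 else 0

theorem abs_hit_le_one (h : X → Fin K) (p : X × Fin K) : |hit h p| ≤ 1 := by
  unfold hit
  split_ifs <;> simp

variable [MeasurableSpace X] {h : X → Fin K}

theorem measurableSet_hit (hh : Measurable h) : MeasurableSet {p : X × Fin K | h p.1 = p.2} :=
  measurableSet_eq_fun (hh.comp measurable_fst) measurable_snd

theorem measurable_hit (hh : Measurable h) : Measurable (hit h) :=
  .ite (measurableSet_hit hh) measurable_const measurable_const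

theorem memLp_two_hit (hh : Measurable h) (μ : Measure (X × Fin K)) [IsFiniteMeasure μ] :
    MemLp (hit h) 2 μ :=
  memLp_two_of_abs_le (measurable_hit hh) (abs_hit_le_one h)

theorem integral_hit_sq_le_one (hh : Measurable h) (μ : Measure (X × Fin K))
    [IsProbabilityMeasure μ] : ∫ p, hit h p ^ 2 ∂μ ≤ 1 :=
  (integral_sq_le_of_abs_le (measurable_hit hh) (abs_hit_le_one h)).trans_eq (one_pow 2)

theorem err_toReal (hh : Measurable h) (D : Measure (X × Fin K)) [IsProbabilityMeasure D] :
    (err D h).toReal = 1 - ∫ p, hit h p ∂D := by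
  have hcompl : {p : X × Fin K | h p.1 ≠ p.2} = {p | h p.1 = p.2}ᶜ := rfl
  have hindicator : hit h = {p : X × Fin K | h p.1 = p.2}.indicator 1 := by
    funext p
    simp [hit, Set.indicator_apply]
  rw [err, hcompl, hindicator, integral_indicator_one (measurableSet_hit hh),
    ← probReal_compl_eq_one_sub (measurableSet_hit hh), measureReal_def]

theorem integral_hit_sub_le_of_err_le {D : Measure (X × Fin K)} [IsProbabilityMeasure D]
    {C : Set (X → Fin K)} {f : X → Fin K} (hfC : f ∈ C) (hf : Measurable f) (hh : Measurable h)
    {ε : ℝ} (hε : 0 ≤ ε) (herr : err D h ≤ opt C D + ENNReal.ofReal ε) :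
    ∫ p, hit f p ∂D - ε ≤ ∫ p, hit h p ∂D := by
  have hle : err D h ≤ err D f + ENNReal.ofReal ε :=
    herr.trans (add_le_add_left (iInf₂_le f hfC) _)
  have hfin : err D f ≠ ⊤ := measure_ne_top D _
  have hreal := ENNReal.toReal_mono (by finiteness) hle
  rw [ENNReal.toReal_add hfin ENNReal.ofReal_ne_top, ENNReal.toReal_ofReal hε,
    err_toReal hh, err_toReal hf] at hreal
  linarith

theorem integral_hit_nullDist {d : ℕ} [NeZero K] {h : EuclideanSpace ℝ (Fin d) → Fin K}
    (hh : Measurable h) : ∫ p, hit h p ∂(nullDist d K) = 1 / K := by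
  have hint : Integrable (hit h) (nullDist d K) := (memLp_two_hit hh _).integrable one_le_two
  rw [nullDist] at hint ⊢
  rw [integral_prod _ hint]
  simp [integral_uniformLabel, hit]

end Hit

namespace IsMomentMatching

variable {d K n : ℕ} [NeZero K] {F : ℝ → Fin K} {E : Fin K → Fin K → ℝ}
  (hE : IsMomentMatching n F E) {v : EuclideanSpace ℝ (Fin d)}

include hE

theorem integral_hit_hiddenDist {h : EuclideanSpace ℝ (Fin d) → Fin K} (hh : Measurable h) :
    ∫ p, hit h p ∂(hiddenDist F E v)
      = 1 / K + ∫ p, hit h p * hiddenPert F E v p ∂(nullDist d K) := by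
  rw [← integral_hit_nullDist hh, ← sub_eq_iff_eq_add', hiddenDist,
    (hE.isPerturbation_hiddenPert v).integral_perturb_sub (memLp_two_hit hh _)]

theorem le_integral_hit_mul_hiddenPert_self (hv : ‖v‖ = 1) :
    1 / (48 * K) ≤ ∫ p, hit (fun x => F (inner ℝ v x)) p * hiddenPert F E v p
      ∂(nullDist d K) := by
  have hF := hE.measurable
  have hint : Integrable
      (fun p => hit (fun x => F (inner ℝ v x)) p * hiddenPert F E v p) (nullDist d K) :=
    (memLp_two_hit (by fun_prop) _).integrable_mul (hE.isPerturbation_hiddenPert v).memLp_two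
  have hdiag : ∫ x, E (F (inner ℝ v x)) (F (inner ℝ v x)) ∂(stdGaussian (EuclideanSpace ℝ (Fin d)))
      = ∫ z, E (F z) (F z) ∂(gaussianReal 0 1) := by
    rw [← map_inner_stdGaussian hv, integral_map (by fun_prop)
      (hE.measurable_comp fun l => E l l).aestronglyMeasurable]
  have hK : (0 : ℝ) < K := Nat.cast_pos.2 (NeZero.pos K)
  rw [nullDist] at hint ⊢
  rw [integral_prod _ hint]
  simp only [integral_uniformLabel, hit, hiddenPert, ite_mul, one_mul, zero_mul,
    Finset.sum_ite_eq, Finset.mem_univ, if_true, integral_div]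
  rw [hdiag, div_div, div_le_div_iff₀ (by positivity) (by positivity)]
  nlinarith [hE.gap]

theorem le_integral_hit_mul_hiddenPert_of_err_le (hv : ‖v‖ = 1)
    (hlin : (fun x => F (inner ℝ v x)) ∈ linearClassifiers d K) {ε : ℝ} (hε0 : 0 ≤ ε)
    (hε : ε ≤ 1 / (96 * K)) {h : EuclideanSpace ℝ (Fin d) → Fin K} (hh : Measurable h)
    (herr : err (hiddenDist F E v) h
      ≤ opt (linearClassifiers d K) (hiddenDist F E v) + ENNReal.ofReal ε) :
    1 / (96 * K) ≤ ∫ p, hit h p * hiddenPert F E v p ∂(nullDist d K) := by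
  have : IsProbabilityMeasure (hiddenDist F E v) :=
    (hE.isPerturbation_hiddenPert v).isProbabilityMeasure_perturb
  have hF := hE.measurable
  have hcompare := integral_hit_sub_le_of_err_le hlin (by fun_prop) hh hε0 herr
  rw [hE.integral_hit_hiddenDist hh, hE.integral_hit_hiddenDist (by fun_prop)] at hcompare
  have hhalf : (1 : ℝ) / (48 * K) = 1 / (96 * K) + 1 / (96 * K) := by
    have hK : (K : ℝ) ≠ 0 := NeZero.ne _
    field_simp
    norm_num
  linarith [hE.le_integral_hit_mul_hiddenPert_self hv]

theorem card_le_of_err_le {ι : Type*} {v : ι → EuclideanSpace ℝ (Fin d)} (hv : ∀ i, ‖v i‖ = 1)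
    (hlin : ∀ i, (fun x => F (inner ℝ (v i) x)) ∈ linearClassifiers d K) {τ : ℝ} (hτ0 : 0 ≤ τ)
    (hτ : ∀ i j, i ≠ j →
      |∫ p, hiddenPert F E (v i) p * hiddenPert F E (v j) p ∂(nullDist d K)| ≤ τ)
    (hτK : 2 * τ ≤ (1 / (96 * K)) ^ 2) {ε : ℝ} (hε0 : 0 ≤ ε) (hε : ε ≤ 1 / (96 * K))
    {h : EuclideanSpace ℝ (Fin d) → Fin K} (hh : Measurable h) {S : Finset ι}
    (hS : ∀ i ∈ S, err (hiddenDist F E (v i)) h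
      ≤ opt (linearClassifiers d K) (hiddenDist F E (v i)) + ENNReal.ofReal ε) :
    S.card ≤ 4608 * (K : ℝ) ^ 2 := by
  have hK : (0 : ℝ) < K := Nat.cast_pos.2 (NeZero.pos K)
  have hsq := integral_hit_sq_le_one hh (nullDist d K)
  have hcard := card_mul_sq_le_of_le_abs_integral_mul
    (fun i => hE.isPerturbation_hiddenPert (v i)) hτ0 hτ (memLp_two_hit hh _)
    (t := 1 / (96 * K)) (by positivity) (fun i hi =>
      (hE.le_integral_hit_mul_hiddenPert_of_err_le (hv i) (hlin i) hε0 hε hh (hS i hi)).trans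
        (le_abs_self _)) (by nlinarith)
  rw [div_pow, one_pow, mul_one_div, div_le_iff₀ (by positivity)] at hcard
  nlinarith [sq_nonneg (96 * (K : ℝ))]

end IsMomentMatching

/-! ### The lower bound -/

section Decoy

variable {X : Type*} [MeasurableSpace X] {μ D : Measure X}

open scoped Classical in
/-- The oracle for `D` that answers every query with its expectation over `μ` as long as this is
within the tolerance, and with the exact expectation over `D` otherwise. -/
noncomputable def decoyOracle (μ D : Measure X) (q : Query X) : ℝ :=
  if q.Distinguishes μ D then ∫ x, q.fn x ∂D else ∫ x, q.fn x ∂μ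

theorem isVSTAT_decoyOracle (μ D : Measure X) : IsVSTAT (decoyOracle μ D) D := by
  intro q
  unfold decoyOracle
  split_ifs with hq
  · rw [sub_self, abs_zero]
    exact (q.tolerance_pos D).le
  · exact not_lt.1 hq

theorem decoyOracle_of_not_distinguishes {q : Query X} (hq : ¬ q.Distinguishes μ D) :
    decoyOracle μ D q = ∫ x, q.fn x ∂μ :=
  if_neg hq

theorem card_mul_le_of_almost_orthogonal [IsProbabilityMeasure μ] {ι Y Ω : Type*} [Fintype ι]
    [MeasurableSpace Ω] {P : Measure Ω} [IsProbabilityMeasure P] {g : ι → X → ℝ}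
    (hg : ∀ i, IsPerturbation μ (g i)) {τ : ℝ} (hτ0 : 0 ≤ τ)
    (hτ : ∀ i j, i ≠ j → |∫ x, g i x * g j x ∂μ| ≤ τ) {U B : ℝ} (hU : 0 ≤ U) (hB : 0 ≤ B)
    (hUτ : 4 * U * τ ≤ 1) {Success : ι → Y → Prop} {L p : ℝ}
    (hL : ∀ (y : Y) (S : Finset ι), (∀ i ∈ S, Success i y) → S.card ≤ L) (A : Ω → SQAlg X Y)
    (hcheap : ∀ i, ∀ᵐ ω ∂P,
      ((A ω).queries (decoyOracle μ (perturb μ (g i)))).length < B ∧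
        ∀ q ∈ (A ω).queries (decoyOracle μ (perturb μ (g i))), q.u < U)
    (hfail : ∀ i,
      P.real {ω | ¬ Success i ((A ω).result (decoyOracle μ (perturb μ (g i))))} ≤ p) :
    Fintype.card ι * (1 - p) ≤ L + B * U := by
  classical
  set O : ι → Query X → ℝ := fun i => decoyOracle μ (perturb μ (g i))
  obtain ⟨ω, hω, S₁, hS₁, hsuccess⟩ := exists_card_le_forall_notMem hfail (ae_all_iff.2 hcheap)
  obtain ⟨S₂, hS₂, hresult⟩ := exists_result_eq (fun q => ∫ x, q.fn x ∂μ) O U ⌊U⌋₊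
    (fun q hq => ⟨Finset.univ.filter fun i => q.Distinguishes μ (perturb μ (g i)),
      Nat.le_floor ((card_le_of_distinguishes hg hτ0 hτ
        ((by gcongr : 4 * q.u * τ ≤ 4 * U * τ).trans hUτ)
        fun i hi => (Finset.mem_filter.1 hi).2).trans hq.le),
      fun i hi => decoyOracle_of_not_distinguishes (by simpa using hi)⟩) ⌊B⌋₊ (A ω)
  have hS₂U : (S₂.card : ℝ) ≤ B * U :=
    calc (S₂.card : ℝ) ≤ (⌊B⌋₊ : ℝ) * ⌊U⌋₊ := by exact_mod_cast hS₂
      _ ≤ B * U := by gcongr <;> exact Nat.floor_le ‹_›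
  have hrest : ((S₁ ∪ S₂)ᶜ.card : ℝ) ≤ L := by
    refine hL ((A ω).result fun q => ∫ x, q.fn x ∂μ) _ fun i hi => ?_
    rw [Finset.mem_compl, Finset.mem_union, not_or] at hi
    rw [← hresult i hi.2 (Nat.le_floor (hω i).1.le) (hω i).2]
    exact not_not.1 (hsuccess i hi.1)
  have hcard : (Fintype.card ι : ℝ) ≤ (S₁ ∪ S₂)ᶜ.card + (S₁.card + S₂.card) := by
    rw [← Finset.card_compl_add_card (S₁ ∪ S₂)]
    exact_mod_cast Nat.add_le_add_left (Finset.card_union_le _ _) _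
  linarith

end Decoy

theorem IsMomentMatching.exists_hard_input {ι : Type*} [Fintype ι] {d K n : ℕ} [NeZero K]
    {F : ℝ → Fin K} {E : Fin K → Fin K → ℝ} (hE : IsMomentMatching n F E)
    {v : ι → EuclideanSpace ℝ (Fin d)} (hv : ∀ i, ‖v i‖ = 1)
    (hlin : ∀ i, (fun x => F (inner ℝ (v i) x)) ∈ linearClassifiers d K) {r : ℝ} (hr : 0 < r)
    (hr8 : r ≤ 1 / 8) (hvr : ∀ i j, i ≠ j → |inner ℝ (v i) (v j)| ≤ r) {τ : ℝ}
    (hτ : (4 * r) ^ n ≤ τ) (hτK : 2 * τ ≤ (1 / (96 * K)) ^ 2) {U B : ℝ} (hU : 0 ≤ U) (hB : 0 ≤ B)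
    (hUτ : 4 * U * τ ≤ 1) (hcard : 3 * (B * U) + 13824 * (K : ℝ) ^ 2 < 2 * Fintype.card ι)
    {γ ε : ℝ} (hγ : γ < 1 / (12 * K)) (hε0 : 0 ≤ ε) (hε : ε ≤ 1 / (96 * K))
    {Ω : Type*} [MeasurableSpace Ω] (P : Measure Ω) [IsProbabilityMeasure P]
    (A : Ω → SQAlg (Example d K) (Hypothesis d K)) (hA : Learns P d K γ ε A) :
    ∃ D : Measure (Example d K), IsInput d K γ D ∧ ∃ O : Query (Example d K) → ℝ, IsVSTAT O D ∧
      0 < P {ω | B ≤ (((A ω).queries O).length : ℝ) ∨ ∃ q ∈ (A ω).queries O, U ≤ q.u} := by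
  by_contra! hcheap
  have hτ0 : 0 ≤ τ := le_trans (by positivity) hτ
  have hcorr : ∀ i j, i ≠ j →
      |∫ p, hiddenPert F E (v i) p * hiddenPert F E (v j) p ∂(nullDist d K)| ≤ τ :=
    fun i j hij => (hE.abs_integral_hiddenPert_mul_le (hv i) (hv j) hr hr8 (hvr i j hij)).trans hτ
  have hinput : ∀ i, IsInput d K γ (hiddenDist F E (v i)) := fun i =>
    hE.isInput_hiddenDist (hlin i) hγ
  have hbound := card_mul_le_of_almost_orthogonal (P := P) (p := 1 / 3)
    (Success := fun i (y : Hypothesis d K) => err (hiddenDist F E (v i)) y.1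
      ≤ opt (linearClassifiers d K) (hiddenDist F E (v i)) + ENNReal.ofReal ε)
    (fun i => hE.isPerturbation_hiddenPert (v i)) hτ0 hcorr hU hB hUτ
    (fun y S hS => hE.card_le_of_err_le hv hlin hτ0 hcorr hτK hε0 hε y.2 hS) A
    (fun i => by
      have hnull := nonpos_iff_eq_zero.1 (hcheap _ (hinput i) _
        (isVSTAT_decoyOracle (nullDist d K) _))
      filter_upwards [measure_eq_zero_iff_ae_notMem.1 hnull] with ω hω
      simp only [not_or, not_le, not_exists, not_and] at hω
      exact hω)
    (fun i => ENNReal.toReal_le_of_le_ofReal (by norm_num)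
      ((hA _ (hinput i) _ (isVSTAT_decoyOracle (nullDist d K) _)).trans_eq (by
        rw [ENNReal.ofReal_div_of_pos three_pos]
        simp)))
  linarith

section Parameters

theorem eventually_large_parameters {c δ : ℝ} (hc : 0 < c) (hδ : 0 < δ) :
    ∀ᶠ d : ℕ in Filter.atTop, 0 < d ∧ 18432 ≤ (d : ℝ) ^ c ∧ 8 ≤ (d : ℝ) ^ (δ / 8) ∧
      2 * (16 + Real.log d) ≤ (d : ℝ) ^ (δ / 2) := by
  have hnat := tendsto_natCast_atTop_atTop (R := ℝ)
  have hlog := hnat.eventually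
    ((isLittleO_log_rpow_atTop (half_pos hδ)).bound (by norm_num : (0 : ℝ) < 1 / 4))
  have hlarge : ∀ {s : ℝ}, 0 < s → ∀ b : ℝ, ∀ᶠ d : ℕ in Filter.atTop, b ≤ (d : ℝ) ^ s :=
    fun hs b => ((tendsto_rpow_atTop hs).comp hnat).eventually_ge_atTop b
  filter_upwards [Filter.eventually_gt_atTop 0, hlarge hc 18432,
    hlarge (by positivity : 0 < δ / 8) 8, hlarge (half_pos hδ) 64, hlog]
    with d hd hdc hd8 hd2 hdlog
  refine ⟨hd, hdc, hd8, ?_⟩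
  rw [Real.norm_eq_abs, Real.norm_of_nonneg (by positivity)] at hdlog
  linarith [le_abs_self (Real.log d)]

theorem rpow_neg_le_one_div_eight {d δ : ℝ} (hd : 1 ≤ d) (hδ : 0 ≤ δ) (hd8 : 8 ≤ d ^ (δ / 8)) :
    d ^ (-(δ / 4)) ≤ 1 / 8 := by
  rw [Real.rpow_neg (by linarith), ← one_div]
  exact one_div_le_one_div_of_le (by norm_num)
    (hd8.trans (Real.rpow_le_rpow_of_exponent_le hd (by linarith)))

theorem four_mul_rpow_pow_le {d δ c : ℝ} {K n : ℕ} (hd : 1 ≤ d) (hδ : 0 ≤ δ) (hc : 0 < c)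
    (hd8 : 8 ≤ d ^ (δ / 8)) (hKn : K ≤ c * n) :
    (4 * d ^ (-(δ / 4))) ^ n ≤ ((d ^ (δ / (16 * c) * K)) ^ 2)⁻¹ := by
  have hd0 : 0 < d := by linarith
  have hbase : 4 * d ^ (-(δ / 4)) ≤ (d ^ (δ / 8))⁻¹ := by
    have hsq : d ^ (δ / 4) = d ^ (δ / 8) * d ^ (δ / 8) := by
      rw [← Real.rpow_add hd0]
      ring_nf
    rw [Real.rpow_neg hd0.le, hsq, ← div_eq_mul_inv, div_le_iff₀ (by positivity),
      inv_mul_cancel_left₀ (by positivity)]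
    linarith
  calc (4 * d ^ (-(δ / 4))) ^ n ≤ ((d ^ (δ / 8))⁻¹) ^ n := by gcongr
    _ = (d ^ (δ / 8 * n))⁻¹ := by rw [inv_pow, Real.rpow_mul hd0.le, Real.rpow_natCast]
    _ ≤ (d ^ (δ / 8 * (K / c)))⁻¹ := by
        gcongr
        exact (div_le_iff₀' hc).2 hKn
    _ = ((d ^ (δ / (16 * c) * K)) ^ 2)⁻¹ := by
        rw [← Real.rpow_natCast, ← Real.rpow_mul hd0.le]
        congr 2
        push_cast
        field_simp
        ring

theorem sq_le_rpow_mul {x c : ℝ} (hx : 0 ≤ x) (hxc : 4 ≤ x ^ c) (K : ℕ) :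
    (K : ℝ) ^ 2 ≤ x ^ (c * K) := by
  have hK : (K : ℝ) ≤ 2 ^ K := by exact_mod_cast Nat.lt_two_pow_self.le
  calc (K : ℝ) ^ 2 ≤ (2 ^ K) ^ 2 := by gcongr
    _ = 4 ^ K := by
        rw [← pow_mul, mul_comm, pow_mul]
        norm_num
    _ ≤ (x ^ c) ^ K := by gcongr
    _ = x ^ (c * K) := by rw [Real.rpow_mul hx, Real.rpow_natCast]

theorem two_mul_inv_sq_le {V K : ℝ} (hV : 18432 ≤ V) (hK : 0 < K) (hKV : K ^ 2 ≤ V) :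
    2 * (V ^ 2)⁻¹ ≤ (1 / (96 * K)) ^ 2 := by
  have hV0 : 0 < V := by linarith
  rw [div_pow, one_pow, ← div_eq_mul_inv, div_le_div_iff₀ (by positivity) (by positivity)]
  nlinarith [mul_le_mul hV hKV (sq_nonneg K) hV0.le]

theorem four_mul_mul_inv_sq_le {V : ℝ} (hV : 4 ≤ V) : 4 * V * (V ^ 2)⁻¹ ≤ 1 := by
  rw [← div_eq_mul_inv, div_le_one (pow_pos (by linarith) 2)]
  nlinarith

theorem rpow_mul_le_exp {d c k y : ℝ} (hd : 1 ≤ d) (hc : c ≤ 1) (hk : 0 ≤ k) (hky : k ≤ y) :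
    d ^ (c * k) ≤ Real.exp (y * Real.log d) := by
  rw [Real.rpow_def_of_pos (by linarith), mul_comm, Real.exp_le_exp]
  gcongr
  · exact Real.log_nonneg hd
  · exact (mul_le_of_le_one_left hk hc).trans hky

theorem two_rpow_le_exp {y : ℝ} (hy : 0 ≤ y) : (2 : ℝ) ^ y ≤ Real.exp y := by
  rw [← Real.exp_one_rpow]
  gcongr
  exact Real.exp_one_gt_two.le

theorem mul_rpow_neg_sq {d δ : ℝ} (hd : 0 < d) :
    d * (d ^ (-(δ / 4))) ^ 2 = d ^ (1 - δ) * d ^ (δ / 2) := by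
  nth_rewrite 1 [← Real.rpow_one d]
  rw [← Real.rpow_natCast, ← Real.rpow_mul hd.le, ← Real.rpow_add hd, ← Real.rpow_add hd]
  congr 1
  push_cast
  ring

theorem mul_exp_lt_exp {y l t : ℝ} (hy : 2 ≤ y) (ht : 2 * (16 + l) ≤ t) :
    13827 * Real.exp (y + y * l) < Real.exp (y * t / 2) := by
  have hbig : (13827 : ℝ) < Real.exp 14 := by
    calc (13827 : ℝ) < 2 ^ 14 := by norm_num
      _ ≤ Real.exp 1 ^ 14 := by
          gcongr
          exact Real.exp_one_gt_two.le
      _ = Real.exp 14 := by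
          rw [← Real.exp_nat_mul]
          norm_num
  calc 13827 * Real.exp (y + y * l) < Real.exp 14 * Real.exp (y + y * l) := by gcongr
    _ = Real.exp (14 + (y + y * l)) := (Real.exp_add _ _).symm
    _ ≤ Real.exp (y * t / 2) := by
        gcongr
        nlinarith [mul_le_mul_of_nonneg_left ht (by linarith : 0 ≤ y)]

theorem budget_lt_two_mul_card {d δ c m : ℝ} {K : ℕ} (hd : 1 ≤ d) (hc : c ≤ 1) (hK : 2 ≤ K)
    (hKd : K ≤ d ^ (1 - δ)) (hlog : 2 * (16 + Real.log d) ≤ d ^ (δ / 2))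
    (hKV : (K : ℝ) ^ 2 ≤ d ^ (c * K)) (hm : Real.exp (d * (d ^ (-(δ / 4))) ^ 2 / 2) / 2 ≤ m) :
    3 * ((2 : ℝ) ^ d ^ (1 - δ) * d ^ (c * K)) + 13824 * (K : ℝ) ^ 2 < 2 * m := by
  rw [mul_rpow_neg_sq (by linarith)] at hm
  set y := d ^ (1 - δ)
  have hy : 2 ≤ y := le_trans (by exact_mod_cast hK) hKd
  have hV : d ^ (c * K) ≤ Real.exp (y * Real.log d) := rpow_mul_le_exp hd hc K.cast_nonneg hKd
  have hBV : (2 : ℝ) ^ y * d ^ (c * K) ≤ Real.exp (y + y * Real.log d) := by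
    rw [Real.exp_add]
    gcongr
    exact two_rpow_le_exp (by linarith)
  have hKexp : (K : ℝ) ^ 2 ≤ Real.exp (y + y * Real.log d) :=
    (hKV.trans hV).trans (Real.exp_le_exp.2 (by linarith))
  linarith [mul_exp_lt_exp hy hlog]

theorem one_div_pow_eight_le {x : ℝ} (hx : 2 ≤ x) : 1 / x ^ 8 ≤ 1 / (96 * x) := by
  have hpow : (2 : ℝ) ^ 7 ≤ x ^ 7 := by gcongr
  refine one_div_le_one_div_of_le (by positivity) ?_
  rw [pow_succ]
  nlinarith

end Parameters

end SQRCN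

theorem theorem5p3_general :
    ∀ δ : ℝ, 0 < δ → δ < 1 → ∃ c : ℝ, 0 < c ∧ ∃ d₀ : ℕ,
      ∀ d K : ℕ, d₀ ≤ d → 2 ≤ K → (K : ℝ) ≤ (d : ℝ) ^ (1 - δ) →
      ∀ γ ε : ℝ, γ < 1 / (12 * K) → 0 ≤ ε → ε ≤ 1 / (96 * K) →
      ∀ (Ω : Type*) [MeasurableSpace Ω] (P : Measure Ω) [IsProbabilityMeasure P]
        (A : Ω → SQRCN.SQAlg (SQRCN.Example d K) (SQRCN.Hypothesis d K)),
        SQRCN.Learns P d K γ ε A →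
        ∃ D : Measure (SQRCN.Example d K), SQRCN.IsInput d K γ D ∧
          ∃ O : SQRCN.Query (SQRCN.Example d K) → ℝ, SQRCN.IsVSTAT O D ∧
            0 < P {ω | (2 : ℝ) ^ ((d : ℝ) ^ (1 - δ)) ≤ (((A ω).queries O).length : ℝ) ∨
              ∃ q ∈ (A ω).queries O, (d : ℝ) ^ (c * (K : ℝ)) ≤ q.u} := by
  intro δ hδ hδ1
  obtain ⟨c₀, hc₀, hclassifier⟩ := SQRCN.exists_linearClassifier_isMomentMatching
  replace hc₀ : (1 : ℝ) ≤ c₀ := by exact_mod_cast hc₀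
  have hc : 0 < δ / (16 * c₀) := by positivity
  have hc1 : δ / (16 * c₀) ≤ 1 := (div_le_one (by positivity)).2 (by linarith)
  obtain ⟨d₀, hd₀⟩ := Filter.eventually_atTop.1 (SQRCN.eventually_large_parameters hc hδ)
  refine ⟨_, hc, d₀, fun d K hd hK hKd γ ε hγ hε0 hε Ω _ P _ A hA => ?_⟩
  obtain ⟨hdpos, hdc, hd8, hlog⟩ := hd₀ d hd
  obtain ⟨n, hKn, F, E, hlin, hE⟩ := hclassifier K hK
  have : NeZero K := ⟨by omega⟩
  have : Nonempty (Fin d) := ⟨⟨0, hdpos⟩⟩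
  have hd1 : (1 : ℝ) ≤ d := by exact_mod_cast hdpos
  have hr8 := SQRCN.rpow_neg_le_one_div_eight hd1 hδ.le hd8
  obtain ⟨m, v, hm, hv, hvr⟩ := SQRCN.exists_almost_orthogonal (ι := Fin d)
    (r := (d : ℝ) ^ (-(δ / 4))) (by positivity) (by linarith)
  rw [Fintype.card_fin] at hm
  have hKV := SQRCN.sq_le_rpow_mul (by linarith) (by linarith : 4 ≤ (d : ℝ) ^ (δ / (16 * c₀))) K
  have hV : 18432 ≤ (d : ℝ) ^ (δ / (16 * c₀) * K) := hdc.trans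
    (Real.rpow_le_rpow_of_exponent_le hd1 (le_mul_of_one_le_right hc.le (by norm_cast; omega)))
  exact hE.exists_hard_input hv (fun i => hlin d (v i)) (by positivity) hr8 hvr
    (SQRCN.four_mul_rpow_pow_le hd1 hδ.le (by positivity) hd8 (by exact_mod_cast hKn))
    (SQRCN.two_mul_inv_sq_le hV (by positivity) hKV) (by positivity) (by positivity)
    (SQRCN.four_mul_mul_inv_sq_le (by linarith))
    (by simpa only [Fintype.card_fin] using
      SQRCN.budget_lt_two_mul_card hd1 hc1 hK hKd hlog hKV hm) hγ hε0 hε P A hA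

theorem theorem5p3 :
    ∃ C : ℕ, ∀ δ : ℝ, 0 < δ → δ < 1 →
      ∃ a : ℝ, 0 < a ∧ ∃ c : ℝ, 0 < c ∧ ∃ d₀ : ℕ,
        ∀ d K : ℕ, d₀ ≤ d → 2 ≤ K → (K : ℝ) ≤ (d : ℝ) ^ (1 - δ) →
        ∀ γ ε : ℝ, 0 < γ → γ ≤ 1 / (K : ℝ) ^ C → 0 < ε → ε ≤ 1 / (K : ℝ) ^ C →
        ∀ (Ω : Type*) [MeasurableSpace Ω] (P : Measure Ω) [IsProbabilityMeasure P]
          (A : Ω → SQRCN.SQAlg (SQRCN.Example d K) (SQRCN.Hypothesis d K)),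
          SQRCN.Learns P d K γ ε A →
          ∃ D : Measure (SQRCN.Example d K), SQRCN.IsInput d K γ D ∧
            ∃ O : SQRCN.Query (SQRCN.Example d K) → ℝ, SQRCN.IsVSTAT O D ∧
              0 < P {ω | (2 : ℝ) ^ ((d : ℝ) ^ a) ≤ (((A ω).queries O).length : ℝ) ∨
                ∃ q ∈ (A ω).queries O, (d : ℝ) ^ (c * (K : ℝ)) ≤ q.u} := by
  refine ⟨8, fun δ hδ hδ1 => ?_⟩
  obtain ⟨c, hc, d₀, hhard⟩ := theorem5p3_general δ hδ hδ1
  refine ⟨1 - δ, sub_pos.2 hδ1, c, hc, d₀, fun d K hd hK hKd γ ε _ hγ hε0 hε => ?_⟩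
  have hle := SQRCN.one_div_pow_eight_le (x := K) (by exact_mod_cast hK)
  have hlt : (1 : ℝ) / (96 * K) < 1 / (12 * K) := by gcongr; norm_num
  exact hhard d K hd hK hKd γ ε ((hγ.trans hle).trans_lt hlt) hε0.le (hε.trans hle)
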